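/- Let $n$ be a positive integer and $j,k,l$ integers. Let $F$ be the free group with basis $x_0,\dots,x_{n-1}$ (subscripts modulo $n$), let $\theta_F$ be the automorphism $x_i\mapsto x_{i+1}$, and let $w=x_0x_jx_kx_l$. Let $\mathcal P=\mathcal P_n(w)$ be the cyclic presentation $\langle x_0,\dots,x_{n-1}\mid w,\theta_F(w),\dots,\theta_F^{n-1}(w)\rangle$, let $G=G_n(x_0x_jx_kx_l)$ be the group it presents, and let $\theta_G$ (the shift) be the automorphism of $G$ induced by $\theta_F$; it satisfies $\theta_G^n=1$. The shift action is free if, for $0<d<n$, the power $\theta_G^d$ fixes no nonidentity element of $G$. A presentation $\langle \mathbf x\mid\mathbf r\rangle$ of a group $G$ is combinatorially aspherical if the following holds. Let $F=F(\mathbf x)$, let $\mathbb F$ be the free group with basis $F\times\mathbf r$, with $F$ acting by $v\cdot(u,r)=(vu,r)$, let $\partial:\mathbb F\to F$ be given by $(u,r)\mapsto uru^{-1}$, let $\mathbb I=\ker\partial$, and let $\mathbb P$ be the normal closure in $\mathbb F$ of the Peiffer identities $(u,r)^{\epsilon}(v,s)^{\delta}(u,r)^{-\epsilon}(ur^{\epsilon}u^{-1}v,s)^{-\delta}$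 ($u,v\in F$, $r,s\in\mathbf r$, $\epsilon,\delta=\pm1$). Then the $\mathbb ZG$-module $\mathbb I/\mathbb P$ is generated by the classes of the elements of $\mathbb I$ of length two in $\mathbb F$. Assume, with all congruences modulo $n$, that (A) $2k\equiv0$ or $2j\equiv2l$, and (B) $k\equiv2j$ or $k\equiv2l$ or $j+l\equiv2k$ or $j+l\equiv0$ hold, and that (C) $l\equiv j+k$ or $l\equiv j-k$ fails. Let $\gamma=\gcd(n,\,k-2j,\,j-2k+l,\,k-2l,\,j+l)$. Then: (a) The shift action on $G$ is not free, and $\mathcal P$ is not combinatorially aspherical. (b) The following are equivalent: (i) $G$ is finite; (ii) $\gamma=1$; (iii) $\theta_G$ has a nonidentity fixed point. (c) If $G$ is finite, then $G$ is solvable; moreover $G$ is metacyclic (it has a cyclic normal subgroup with cyclic quotient), or it is a central extension, with cyclic kernel, of a dihedral group of order $2m$ for some $m\ge3$. -/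

import Mathlib

/-! ### Combinatorial asphericity of a group presentation -/

namespace GroupPresentation

/-- For a presentation with generators `X` and relator set `R`, the free group with basis
`F(X) × R`. -/
abbrev RelFree {X : Type*} (R : Set (FreeGroup X)) : Type _ := FreeGroup (FreeGroup X × R)

/-- The boundary homomorphism `(u, r) ↦ u r u⁻¹`. -/
def boundary {X : Type*} (R : Set (FreeGroup X)) : RelFree R →* FreeGroup X :=
  FreeGroup.lift fun p => p.1 * (p.2 : FreeGroup X) * p.1⁻¹

/-- The action of `F(X)` on the free group with basis `F(X) × R`, given on the basis by
`v • (u, r) = (v u, r)`. -/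
def act {X : Type*} (R : Set (FreeGroup X)) (v : FreeGroup X) : RelFree R →* RelFree R :=
  FreeGroup.map fun p => (v * p.1, p.2)

/-- The group of identities (identity sequences) of the presentation. -/
abbrev identities {X : Type*} (R : Set (FreeGroup X)) : Subgroup (RelFree R) :=
  (boundary R).ker

/-- The Peiffer identities
`(u,r)^ε (v,s)^δ (u,r)^(-ε) (u r^ε u⁻¹ v, s)^(-δ)`, with `ε, δ = ±1`. -/
def peifferIdentities {X : Type*} (R : Set (FreeGroup X)) : Set (RelFree R) :=
  {y | ∃ (u v : FreeGroup X) (r s : R) (ε δ : ℤˣ),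
    y = FreeGroup.of (u, r) ^ (ε : ℤ) * FreeGroup.of (v, s) ^ (δ : ℤ) *
      FreeGroup.of (u, r) ^ (-(ε : ℤ)) *
      FreeGroup.of (u * (r : FreeGroup X) ^ (ε : ℤ) * u⁻¹ * v, s) ^ (-(δ : ℤ))}

/-- The normal closure of the Peiffer identities. -/
def peiffer {X : Type*} (R : Set (FreeGroup X)) : Subgroup (RelFree R) :=
  Subgroup.normalClosure (peifferIdentities R)

instance peiffer_normal {X : Type*} (R : Set (FreeGroup X)) : (peiffer R).Normal :=
  Subgroup.normalClosure_normal

theorem boundary_of {X : Type*} (R : Set (FreeGroup X)) (u : FreeGroup X) (r : R) :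
    boundary R (FreeGroup.of (u, r)) = u * (r : FreeGroup X) * u⁻¹ := by
  simp [boundary]

theorem act_of {X : Type*} (R : Set (FreeGroup X)) (v u : FreeGroup X) (r : R) :
    act R v (FreeGroup.of (u, r)) = FreeGroup.of (v * u, r) := by
  simp [act]

theorem act_one {X : Type*} (R : Set (FreeGroup X)) : act R 1 = MonoidHom.id _ := by
  ext p
  obtain ⟨u, r⟩ := p
  simp [act_of]

theorem act_mul {X : Type*} (R : Set (FreeGroup X)) (v w : FreeGroup X) :
    act R (v * w) = (act R v).comp (act R w) := by
  ext p
  obtain ⟨u, r⟩ := p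
  simp [act_of, mul_assoc]

theorem boundary_act {X : Type*} (R : Set (FreeGroup X)) (v : FreeGroup X) (y : RelFree R) :
    boundary R (act R v y) = v * boundary R y * v⁻¹ := by
  have h : (boundary R).comp (act R v) = (MulAut.conj v).toMonoidHom.comp (boundary R) := by
    ext p
    obtain ⟨u, r⟩ := p
    simp [act_of, boundary_of, mul_assoc]
  simpa using DFunLike.congr_fun h y

theorem act_mem_identities {X : Type*} (R : Set (FreeGroup X)) (v : FreeGroup X)
    {y : RelFree R} (hy : y ∈ identities R) : act R v y ∈ identities R := by
  rw [MonoidHom.mem_ker] at hy ⊢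
  rw [boundary_act, hy]
  simp

theorem act_mem_peiffer {X : Type*} (R : Set (FreeGroup X)) (v : FreeGroup X)
    {y : RelFree R} (hy : y ∈ peiffer R) : act R v y ∈ peiffer R := by
  have h : peiffer R ≤ (peiffer R).comap (act R v) := by
    refine Subgroup.normalClosure_le_normal ?_
    rintro _ ⟨a, b, r, s, ε, δ, rfl⟩
    refine Subgroup.subset_normalClosure ⟨v * a, v * b, r, s, ε, δ, ?_⟩
    simp only [map_mul, map_zpow, act_of]
    congr 4
    group
  exact h hy

/-- Modulo Peiffer identities, conjugation by `a` is the action of the boundary of `a`. -/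
theorem mk_conj_eq {X : Type*} (R : Set (FreeGroup X)) (a b : RelFree R) :
    (QuotientGroup.mk (a * b * a⁻¹) : RelFree R ⧸ peiffer R) =
      QuotientGroup.mk (act R (boundary R a) b) := by
  have key : ∀ (u : FreeGroup X) (r : R) (ε : ℤˣ) (b : RelFree R),
      (QuotientGroup.mk (FreeGroup.of (u, r) ^ (ε : ℤ) * b * (FreeGroup.of (u, r) ^ (ε : ℤ))⁻¹) :
        RelFree R ⧸ peiffer R) =
      QuotientGroup.mk (act R (boundary R (FreeGroup.of (u, r) ^ (ε : ℤ))) b) := by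
    intro u r ε b
    have hb : boundary R (FreeGroup.of (u, r) ^ (ε : ℤ)) =
        u * (r : FreeGroup X) ^ (ε : ℤ) * u⁻¹ := by
      rw [map_zpow, boundary_of, conj_zpow]
    have hp : ∀ (v : FreeGroup X) (s : R),
        FreeGroup.of (u, r) ^ (ε : ℤ) * FreeGroup.of (v, s) *
          (FreeGroup.of (u, r) ^ (ε : ℤ))⁻¹ *
          (FreeGroup.of (u * (r : FreeGroup X) ^ (ε : ℤ) * u⁻¹ * v, s))⁻¹ ∈ peiffer R := by
      intro v s
      refine Subgroup.subset_normalClosure ⟨u, v, r, s, ε, 1, ?_⟩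
      simp
    rw [hb]
    generalize FreeGroup.of (u, r) ^ (ε : ℤ) = c at hp
    have h : (QuotientGroup.mk' (peiffer R)).comp (MulAut.conj c).toMonoidHom =
        (QuotientGroup.mk' (peiffer R)).comp
          (act R (u * (r : FreeGroup X) ^ (ε : ℤ) * u⁻¹)) := by
      ext p
      obtain ⟨v, s⟩ := p
      simp only [MonoidHom.comp_apply, MulEquiv.coe_toMonoidHom, MulAut.conj_apply, act_of]
      rw [← mul_inv_eq_one, ← map_inv, ← map_mul, QuotientGroup.mk'_apply,
        QuotientGroup.eq_one_iff]
      exact hp v s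
    exact DFunLike.congr_fun h b
  induction a using FreeGroup.induction_on generalizing b with
  | C1 => simp [act_one]
  | of p =>
    have h := key p.1 p.2 1 b
    rw [Units.val_one, zpow_one] at h
    exact h
  | inv_of p _ =>
    have h := key p.1 p.2 (-1) b
    rw [Units.val_neg, Units.val_one, zpow_neg_one] at h
    exact h
  | mul x y hx hy =>
    rw [map_mul, act_mul, MonoidHom.comp_apply, ← hx]
    have : x * y * b * (x * y)⁻¹ = x * (y * b * y⁻¹) * x⁻¹ := by group
    rw [this, QuotientGroup.mk_mul, QuotientGroup.mk_mul, hy, ← QuotientGroup.mk_mul,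
      ← QuotientGroup.mk_mul]

/-- The second homotopy module of the presentation, as an abstract group: identities modulo
Peiffer identities. -/
abbrev Pi2 {X : Type*} (R : Set (FreeGroup X)) : Type _ :=
  identities R ⧸ (peiffer R).subgroupOf (identities R)

theorem pi2_mk_eq {X : Type*} (R : Set (FreeGroup X)) {a b : identities R}
    (h : (QuotientGroup.mk (a : RelFree R) : RelFree R ⧸ peiffer R) =
      QuotientGroup.mk (b : RelFree R)) :
    (QuotientGroup.mk a : Pi2 R) = QuotientGroup.mk b := by
  rw [QuotientGroup.eq] at h ⊢
  simpa [Subgroup.mem_subgroupOf] using h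

instance pi2CommGroup {X : Type*} (R : Set (FreeGroup X)) : CommGroup (Pi2 R) :=
  { (inferInstance : Group (Pi2 R)) with
    mul_comm := by
      intro x y
      induction x using QuotientGroup.induction_on with | _ a => ?_
      induction y using QuotientGroup.induction_on with | _ b => ?_
      rw [← mul_inv_eq_iff_eq_mul]
      refine pi2_mk_eq R (a := a * b * a⁻¹) ?_
      have h := mk_conj_eq R (a : RelFree R) (b : RelFree R)
      rw [MonoidHom.mem_ker.mp a.2, act_one] at h
      simpa using h }

/-- The action of an element of `F(X)` on identities modulo Peiffer identities. -/
def pi2Act {X : Type*} (R : Set (FreeGroup X)) (v : FreeGroup X) : Pi2 R →* Pi2 R :=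
  QuotientGroup.map _ _
    (((act R v).comp (identities R).subtype).codRestrict (identities R)
      fun y => act_mem_identities R v y.2)
    fun _ hy => act_mem_peiffer R v hy

/-- The action of `F(X)` on the second homotopy module, written additively. -/
def freePi2Rep {X : Type*} (R : Set (FreeGroup X)) :
    FreeGroup X →* Module.End ℤ (Additive (Pi2 R)) where
  toFun v := (MonoidHom.toAdditive (pi2Act R v)).toIntLinearMap
  map_one' := by
    ext x
    induction x using Additive.rec with | _ x => ?_
    induction x using QuotientGroup.induction_on with | _ a => ?_
    exact congrArg Additive.ofMul (pi2_mk_eq R (by simp [act_one]))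
  map_mul' v w := by
    ext x
    induction x using Additive.rec with | _ x => ?_
    induction x using QuotientGroup.induction_on with | _ a => ?_
    exact congrArg Additive.ofMul (pi2_mk_eq R (by simp [act_mul]))

theorem freePi2Rep_eq_one {X : Type*} (R : Set (FreeGroup X)) (v : FreeGroup X)
    (hv : v ∈ Subgroup.normalClosure R) : freePi2Rep R v = 1 := by
  have h : Subgroup.normalClosure R ≤ (freePi2Rep R).ker := by
    refine Subgroup.normalClosure_le_normal fun r hr => ?_
    rw [SetLike.mem_coe, MonoidHom.mem_ker]
    ext x
    induction x using Additive.rec with | _ x => ?_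
    induction x using QuotientGroup.induction_on with | _ a => ?_
    refine congrArg Additive.ofMul (pi2_mk_eq R ?_)
    have h1 := mk_conj_eq R (FreeGroup.of (1, ⟨r, hr⟩)) (a : RelFree R)
    have h2 := mk_conj_eq R (a : RelFree R) (FreeGroup.of (1, ⟨r, hr⟩))
    rw [MonoidHom.mem_ker.mp a.2, act_one, MonoidHom.id_apply] at h2
    rw [boundary_of] at h1
    simp only [one_mul, inv_one, mul_one] at h1
    refine h1.symm.trans ?_
    rw [QuotientGroup.mk_mul, QuotientGroup.mk_mul, QuotientGroup.mk_inv] at h2 ⊢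
    rw [mul_inv_eq_iff_eq_mul] at h2 ⊢
    exact h2.symm
  exact h hv

/-- The second homotopy module as a representation over `ℤ` of the presented group; the
associated module over the integral group ring is `(pi2Rep R).asModule`. -/
def pi2Rep {X : Type*} (R : Set (FreeGroup X)) :
    Representation ℤ (PresentedGroup R) (Additive (Pi2 R)) :=
  QuotientGroup.lift (Subgroup.normalClosure R) (freePi2Rep R) (freePi2Rep_eq_one R)

/-- The class of an identity in the second homotopy module. -/
def pi2Class {X : Type*} (R : Set (FreeGroup X)) (y : identities R) : (pi2Rep R).asModule :=
  (pi2Rep R).asModuleEquiv.symm (Additive.ofMul (QuotientGroup.mk y : Pi2 R))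

open Classical in
/-- A presentation is combinatorially aspherical if its second homotopy module is generated,
over the integral group ring of the presented group, by the classes of those identities that
have length two in the free group with basis `F(X) × R`. -/
def CombinatoriallyAspherical {X : Type*} (R : Set (FreeGroup X)) : Prop :=
  Submodule.span (MonoidAlgebra ℤ (PresentedGroup R))
    {m : (pi2Rep R).asModule |
      ∃ y : identities R, (y : RelFree R).norm = 2 ∧ m = pi2Class R y} = ⊤

end GroupPresentation

/-! ### Cyclic presentations -/

namespace CyclicPresentation

/-- The shift automorphism `x_i ↦ x_{i+1}` of the free group on `x_0, …, x_{n-1}`, subscripts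
modulo `n`. -/
def freeShift (n : ℕ) : MulAut (FreeGroup (ZMod n)) :=
  FreeGroup.freeGroupCongr (Equiv.addRight (1 : ZMod n))

/-- The relators `w, θ(w), …, θ^{n-1}(w)` of the cyclic presentation defined by `w`. -/
def relators (n : ℕ) (w : FreeGroup (ZMod n)) : Set (FreeGroup (ZMod n)) :=
  {r | ∃ i : ℕ, i < n ∧ r = (freeShift n ^ i) w}

/-- The cyclically presented group `G_n(w)`. -/
abbrev CycGroup (n : ℕ) (w : FreeGroup (ZMod n)) : Type := PresentedGroup (relators n w)

theorem freeShift_pow_of (n i : ℕ) (p : ZMod n) :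
    (freeShift n ^ i) (FreeGroup.of p) = FreeGroup.of (p + i) := by
  induction i with
  | zero => simp
  | succ i ih =>
    rw [pow_succ', MulAut.mul_apply, ih]
    simp [freeShift, add_assoc]

theorem freeShift_pow_self (n : ℕ) : freeShift n ^ n = 1 := by
  have h : (freeShift n ^ n).toMonoidHom = MonoidHom.id _ := by
    ext p
    simp [freeShift_pow_of]
  ext y
  simpa using DFunLike.congr_fun h y

theorem freeShift_image_relators (n : ℕ) (w : FreeGroup (ZMod n)) :
    (freeShift n) '' relators n w = relators n w := by
  ext r
  constructor
  · rintro ⟨_, ⟨i, hi, rfl⟩, rfl⟩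
    rcases Nat.lt_or_ge (i + 1) n with h | h
    · exact ⟨i + 1, h, by rw [pow_succ', MulAut.mul_apply]⟩
    · obtain rfl : n = i + 1 := by omega
      refine ⟨0, by omega, ?_⟩
      rw [← MulAut.mul_apply, ← pow_succ', freeShift_pow_self, pow_zero]
  · rintro ⟨i, hi, rfl⟩
    rcases i with _ | i
    · refine ⟨_, ⟨n - 1, by omega, rfl⟩, ?_⟩
      rw [← MulAut.mul_apply, ← pow_succ', Nat.sub_add_cancel (by omega), freeShift_pow_self,
        pow_zero]
    · exact ⟨_, ⟨i, by omega, rfl⟩, by rw [← MulAut.mul_apply, ← pow_succ']⟩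

/-- The shift automorphism of the cyclically presented group. -/
def shift (n : ℕ) (w : FreeGroup (ZMod n)) : MulAut (CycGroup n w) :=
  QuotientGroup.congr (Subgroup.normalClosure (relators n w))
    (Subgroup.normalClosure (relators n w)) (freeShift n) (by
      have h := Subgroup.map_normalClosure (relators n w) (freeShift n).toMonoidHom
        (freeShift n).surjective
      refine h.trans ?_
      congr 1
      exact freeShift_image_relators n w)

/-- The cyclic group of order `n` acts freely, via the shift, on the nonidentity elements of
`G_n(w)`: no power `θ^d` with `0 < d < n` fixes a nonidentity element. -/
def ShiftActsFreely (n : ℕ) (w : FreeGroup (ZMod n)) : Prop :=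
  ∀ d : ℕ, 0 < d → d < n → ∀ g : CycGroup n w, g ≠ 1 → (shift n w ^ d) g ≠ g

/-- The positive word `x_0 x_j x_k x_l`, subscripts modulo `n`. -/
def word (n : ℕ) (j k l : ℤ) : FreeGroup (ZMod n) :=
  FreeGroup.of 0 * FreeGroup.of (j : ZMod n) * FreeGroup.of (k : ZMod n) *
    FreeGroup.of (l : ZMod n)

/-- Condition (A). -/
def CondA (n : ℕ) (j k l : ℤ) : Prop := 2 * k ≡ 0 [ZMOD n] ∨ 2 * j ≡ 2 * l [ZMOD n]

/-- Condition (B). -/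
def CondB (n : ℕ) (j k l : ℤ) : Prop :=
  k ≡ 2 * j [ZMOD n] ∨ k ≡ 2 * l [ZMOD n] ∨ j + l ≡ 2 * k [ZMOD n] ∨ j + l ≡ 0 [ZMOD n]

/-- Condition (C). -/
def CondC (n : ℕ) (j k l : ℤ) : Prop := l ≡ j + k [ZMOD n] ∨ l ≡ j - k [ZMOD n]

/-- The secondary divisor `gcd(n, k-2j, j-2k+l, k-2l, j+l)`. -/
def secondaryDivisor (n : ℕ) (j k l : ℤ) : ℕ :=
  Nat.gcd n (Int.gcd (k - 2 * j) (Int.gcd (j - 2 * k + l) (Int.gcd (k - 2 * l) (j + l))))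

/-- A group is metacyclic if it has a cyclic normal subgroup with cyclic quotient. -/
def IsMetacyclic (G : Type*) [Group G] : Prop :=
  ∃ (N : Subgroup G) (_ : N.Normal), IsCyclic N ∧ IsCyclic (G ⧸ N)

/-- `G` is a central extension, with cyclic kernel, of a dihedral group of order `2m`, where
`m ≥ 3`. -/
def IsCyclicCentralExtensionOfDihedral (G : Type*) [Group G] : Prop :=
  ∃ (m : ℕ) (f : G →* DihedralGroup m), 3 ≤ m ∧ Function.Surjective f ∧
    f.ker ≤ Subgroup.center G ∧ IsCyclic f.ker

end CyclicPresentation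

/-! Pass to the split extension `E` of `G` by the shift, generated by `t` and `x` with `t ^ n = 1`
and `x t^j x t^(k-j) x t^(l-k) x t^(-l) = 1`. The shift is conjugation by `t`, and `G` is the kernel
of a retraction `π` onto ℤ/n. Condition (B) says that two cyclically consecutive exponents agree
modulo `n`. Rotating the relator and putting `y = x t^e` makes those two exponents zero, (A) makes
the other two `p` and `±p`, and the failure of (C) says `p ≢ 0`. Moreover `γ = gcd(n, p)`
(`exists_reduction`).

Exponents `p, -p`: the relation is `t^p y t^(-p) = y^(-3)`. The order of `y` is `|(-3)^r - 1|`, with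
`r` the order of `p` in ℤ/n; the lower bound comes from a permutation representation
(`dvd_of_zpow_eq`). If `γ = 1`, then `t` is a power of `t^p`, so `⟨y⟩` is normal and `E` is finite
metacyclic.

Exponents `p, p`: the relation is `y^2 (y t^p)^2 = 1`, so `y^2` commutes with `t^p`, and `y` inverts
`t^p` up to a power of `y^2`. If `γ = 1`, then `y^2` is central of finite order, and `G` modulo a
subgroup of `⟨y^2⟩` is dihedral (`isMetacyclic_or_isCyclicCentralExtension`).

In both families explicit elements of `G` are nontrivial and torsion, or nontrivial and commuting
with `t^p`. The latter are fixed by a proper power of the shift, and by the shift itself if `γ = 1`.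
If `γ ≠ 1`, then `E` embeds in the amalgam of `⟨t⟩` and `⟨y, t^p⟩` over `⟨t^p⟩`, where the
centralizer of `t` is `⟨t⟩`, which meets `G` trivially (`eq_one_of_commute`); and `E` acts on ℂ so
that a commutator is a nonzero translation, whence `G` is infinite (`infinite_ker`).

For asphericity, map identities to the second cellular chain module of the universal cover. Since
(C) fails, distinct relators are not conjugate and none is a proper power, so identities of length
two map to zero (`hurewicz_eq_zero_of_norm_eq_two`). Were they generators, every identity would map
to zero, and the chain complex, restricted to a finite cyclic subgroup, would force that subgroup to
be trivial (`exists_hurewicz_ne_zero`), contrary to the torsion in `G`. -/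

namespace Monoid.PushoutI

/-! ### Amalgams: reduced words and centralizers. -/

open Function Monoid.CoprodI

variable {ι : Type*} {G : ι → Type*} {H : Type*} [∀ i, Group (G i)] [Group H]
  {φ : ∀ i, H →* G i}

/-- Reduced words representing the same element of an amalgam have the same sequence of indices. -/
theorem Reduced.map_fst_eq (hφ : ∀ i, Injective (φ i)) {v w : Word G} (hv : Reduced φ v)
    (hw : Reduced φ w) (h : ofCoprodI (φ := φ) v.prod = ofCoprodI w.prod) :
    v.toList.map Sigma.fst = w.toList.map Sigma.fst := by
  obtain ⟨d⟩ := NormalWord.transversal_nonempty φ hφ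
  classical
  obtain ⟨v', hv', hv''⟩ := hv.exists_normalWord_prod_eq d
  obtain ⟨w', hw', hw''⟩ := hw.exists_normalWord_prod_eq d
  have : v' = w' := NormalWord.prod_injective (by rw [hv', hw', h])
  rw [← hv'', ← hw'', this]

theorem exists_reduced (hφ : ∀ i, Injective (φ i)) (g : PushoutI φ) :
    ∃ (c : H) (w : Word G), Reduced φ w ∧ g = base φ c * ofCoprodI w.prod := by
  obtain ⟨d⟩ := NormalWord.transversal_nonempty φ hφ
  classical
  let w := g • (NormalWord.empty : NormalWord d)
  have hw : w.prod = g := by simp [w]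
  refine ⟨w.head, w.toWord, ?_, by rw [← hw]; rfl⟩
  rintro ⟨i, a⟩ ha ⟨b, hb⟩
  refine w.ne_one _ ha ?_
  have h1 := w.normalized i a ha
  have h2 : a ∈ (φ i).range := ⟨b, hb⟩
  -- An element of both the subgroup and its transversal factors as `a * 1` and as `1 * a`;
  -- uniqueness gives `a = 1`.
  have h3 := (d.compl i).1 (a₁ := (⟨a, h2⟩, ⟨1, d.one_mem i⟩))
    (a₂ := (⟨1, one_mem _⟩, ⟨a, h1⟩)) (by simp)
  exact (Subtype.ext_iff.1 (Prod.ext_iff.1 h3).2).symm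

/-- The product in an amalgam of a list of letters. -/
def listProd (φ : ∀ i, H →* G i) (L : List (Σ i, G i)) : PushoutI φ :=
  (L.map fun x => of (φ := φ) x.1 x.2).prod

theorem ofCoprodI_prod (w : Word G) : ofCoprodI (φ := φ) w.prod = listProd φ w.toList := by
  simp [Word.prod, listProd, map_list_prod, List.map_map, Function.comp_def]

theorem listProd_reverse_inv (L : List (Σ i, G i)) :
    listProd φ (L.reverse.map fun x => ⟨x.1, x.2⁻¹⟩) = (listProd φ L)⁻¹ := by
  induction L with
  | nil => simp [listProd]
  | cons x L ih => simp_all [listProd]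

/-- An element of an amalgam commuting with an element of a factor, none of whose conjugates in
that factor lies in the amalgamated subgroup, lies in that factor. -/
theorem mem_range_of_of_commute (hφ : ∀ i, Injective (φ i)) {i : ι} {a : G i}
    (ha : ∀ z : G i, z * a * z⁻¹ ∉ (φ i).range) {g : PushoutI φ}
    (hg : g * of i a = of i a * g) : g ∈ (of (φ := φ) i).range := by
  -- When `L` does not end in the factor `i`, the word `L b L⁻¹` is reduced of length `2 |L| + 1`,
  -- whereas the right-hand side has length one.
  have key : ∀ (L : List (Σ i, G i)) (b : G i), L.IsChain (fun l l' => l.1 ≠ l'.1) →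
      (∀ x ∈ L, x.2 ∉ (φ x.1).range) → (∀ x ∈ L.getLast?, x.1 ≠ i) →
      (∀ z : G i, z * b * z⁻¹ ∉ (φ i).range) → ∀ b' : G i, b' ∉ (φ i).range →
      listProd φ L * of i b * (listProd φ L)⁻¹ = of i b' → L = [] := by
    intro L b hL hred hlast hb b' hb' heq
    have hb0 : b ∉ (φ i).range := by simpa using hb 1
    let M : List (Σ i, G i) := L ++ (⟨i, b⟩ :: (L.reverse.map fun x => ⟨x.1, x.2⁻¹⟩))
    have hM : ∀ x ∈ M, x.2 ∉ (φ x.1).range := by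
      intro x hx
      simp only [M, List.mem_append, List.mem_cons, List.mem_map, List.mem_reverse] at hx
      rcases hx with hx | rfl | ⟨y, hy, rfl⟩
      · exact hred x hx
      · exact hb0
      · simpa using hred y hy
    have hone : ∀ N : List (Σ i, G i), (∀ x ∈ N, x.2 ∉ (φ x.1).range) → ∀ x ∈ N, x.2 ≠ 1 :=
      fun N hN x hx h => hN x hx (h ▸ one_mem _)
    have hchain : M.IsChain (fun l l' => l.1 ≠ l'.1) := by
      refine List.isChain_append.2 ⟨hL, List.isChain_cons.2 ⟨?_, ?_⟩, ?_⟩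
      · intro y hy
        simp only [List.head?_map, List.head?_reverse, Option.mem_def, Option.map_eq_some_iff] at hy
        obtain ⟨x, hx, rfl⟩ := hy
        exact (hlast x hx).symm
      · rw [List.isChain_map, List.isChain_reverse]
        exact hL.imp fun _ _ h => h.symm
      · intro x hx y hy
        simp only [List.head?_cons, Option.mem_def, Option.some.injEq] at hy
        subst hy
        exact hlast x hx
    have h := Reduced.map_fst_eq (φ := φ) hφ (v := ⟨M, hone M hM, hchain⟩)
      (w := ⟨[⟨i, b'⟩], hone _ (by simpa using hb'), by simp⟩) hM
      (by intro x hx; simp only [List.mem_singleton] at hx; subst hx; exact hb') (by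
        rw [ofCoprodI_prod, ofCoprodI_prod]
        change listProd φ M = listProd φ [_]
        have : listProd φ M = listProd φ L * of i b * (listProd φ L)⁻¹ := by
          rw [← listProd_reverse_inv]
          simp [M, listProd, mul_assoc]
        rw [this, heq]
        simp [listProd])
    have h2 := congrArg List.length h
    simp only [M, List.length_map, List.length_append, List.length_cons, List.length_reverse,
      List.length_nil] at h2
    exact List.eq_nil_of_length_eq_zero (by omega)
  obtain ⟨c, w, hw, rfl⟩ := exists_reduced hφ g
  have hc : base φ c = of i (φ i c) := (of_apply_eq_base φ i c).symm
  have hconj : ∀ u : G i, ∀ z : G i, z * (u * a * u⁻¹) * z⁻¹ ∉ (φ i).range := by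
    intro u z
    have := ha (z * u)
    simpa only [mul_inv_rev, mul_assoc] using this
  rw [ofCoprodI_prod] at hg ⊢
  rcases List.eq_nil_or_concat' w.toList with h | ⟨L, x, h⟩
  · rw [h, hc]
    exact ⟨φ i c, by simp [listProd]⟩
  have hprod : listProd φ w.toList = listProd φ L * of x.1 x.2 := by
    simp [h, listProd]
  have hwchain := w.chain_ne
  rw [h, List.isChain_append] at hwchain
  have hb' : (φ i c)⁻¹ * a * φ i c ∉ (φ i).range := by simpa using ha (φ i c)⁻¹
  -- A last letter `z` in the factor `i` is absorbed by replacing `a` with `z a z⁻¹`; otherwise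
  -- `key` applies to the whole word, which is nonempty.
  by_cases hx : x.1 = i
  · obtain ⟨i', z⟩ := x
    obtain rfl : i' = i := hx
    have hL : L = [] := by
      refine key L (z * a * z⁻¹) hwchain.1 (fun y hy => hw y (by simp [h, hy])) ?_
        (hconj z) _ hb' ?_
      · intro y hy
        exact hwchain.2.2 y hy ⟨i', z⟩ (by simp)
      · rw [hprod, hc] at hg
        simp only [map_mul, map_inv]
        simp only [← mul_assoc] at hg ⊢
        rw [mul_inv_eq_iff_eq_mul, mul_inv_eq_iff_eq_mul]
        simp only [mul_assoc] at hg ⊢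
        rw [← hg]
        simp
    rw [hprod, hL, hc]
    exact ⟨φ i' c * z, by simp [listProd]⟩
  · exfalso
    have hL : w.toList = [] := by
      refine key w.toList a w.chain_ne hw ?_ ha _ hb' ?_
      · intro y hy
        rw [h] at hy
        simp only [List.getLast?_append, List.getLast?_singleton, Option.some_or, Option.mem_def,
          Option.some.injEq] at hy
        exact hy ▸ hx
      · rw [hc] at hg
        simp only [map_mul, map_inv]
        rw [mul_inv_eq_iff_eq_mul]
        simp only [mul_assoc] at hg ⊢
        rw [← hg]
        simp
    simp [h] at hL

/-- The centralizer of an element `a` of a factor, none of whose conjugates in that factor lies in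
the amalgamated subgroup, for a group with a section of a homomorphism from an amalgam. -/
theorem exists_eq_of_commute (hφ : ∀ i, Injective (φ i)) {E : Type*} [Group E]
    {f : ∀ i, G i →* E} {k : H →* E} (hf : ∀ i, (f i).comp (φ i) = k) {F : E →* PushoutI φ}
    (hF : (lift f k hf).comp F = MonoidHom.id E) {i : ι} {t : E} {a : G i} (ha : F t = of i a)
    (hconj : ∀ z : G i, z * a * z⁻¹ ∉ (φ i).range) {g : E} (hg : g * t = t * g) :
    ∃ z, f i z = g := by
  obtain ⟨z, hz⟩ := mem_range_of_of_commute hφ hconj (g := F g)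
    (by rw [← ha, ← map_mul, hg, map_mul])
  refine ⟨z, ?_⟩
  have h := DFunLike.congr_fun hF g
  rw [MonoidHom.comp_apply, ← hz, lift_of] at h
  exact h

end Monoid.PushoutI

/-! ### The split extension by the shift. -/

theorem exists_multiplicative_zmod_hom {K : Type*} [Group K] {n : ℕ} {u : K} (hu : u ^ n = 1) :
    ∃ f : Multiplicative (ZMod n) →* K, ∀ i : ℤ, f (Multiplicative.ofAdd (i : ZMod n)) = u ^ i := by
  let g : ℤ →+ Additive K := zmultiplesHom (Additive K) (Additive.ofMul u)
  have hg : g n = 0 := by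
    change Additive.ofMul (u ^ (n : ℤ)) = 0
    rw [zpow_natCast, hu]
    rfl
  refine ⟨AddMonoidHom.toMultiplicativeLeft (ZMod.lift n ⟨g, hg⟩), fun i => ?_⟩
  change (ZMod.lift n ⟨g, hg⟩ (i : ZMod n)).toMul = _
  rw [ZMod.lift_coe]
  rfl

theorem zpow_eq_zpow_of_modEq {K : Type*} [Group K] {n : ℕ} {u : K} (hu : u ^ n = 1) {a b : ℤ}
    (h : a ≡ b [ZMOD n]) : u ^ a = u ^ b := by
  obtain ⟨c, hc⟩ := h.dvd
  obtain rfl : b = a + n * c := by omega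
  rw [zpow_add, zpow_mul, zpow_natCast, hu, one_zpow, mul_one]

theorem MonoidHom.eqOn_closure_pair {K H : Type*} [Group K] [Group H] {a b : K}
    (hab : Subgroup.closure {a, b} = ⊤) {f g : K →* H} (ha : f a = g a) (hb : f b = g b) :
    f = g :=
  MonoidHom.eq_of_eqOn_dense hab fun x hx => by
    rcases hx with rfl | rfl
    exacts [ha, hb]

theorem mul_four_eq_one_rotate {K : Type*} [Group K] {u v w z : K} (h : u * v * w * z = 1) :
    v * w * z * u = 1 := by
  rw [mul_assoc, mul_assoc, mul_eq_one_iff_eq_inv] at h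
  rw [h]
  group

namespace CyclicPresentation

/-- `E` is presented by generators `t`, `x` and relations `t ^ n = 1` and
`x t^a x t^b x t^c x t^d = 1`. -/
structure IsQuarticExtension (n : ℕ) (a b c d : ℤ) {E : Type} [Group E] (t x : E) : Prop where
  pow_eq_one : t ^ n = 1
  rel : x * t ^ a * (x * t ^ b) * (x * t ^ c) * (x * t ^ d) = 1
  closure_eq_top : Subgroup.closure {t, x} = ⊤
  exists_hom : ∀ {H : Type} [Group H] (t' x' : H), t' ^ n = 1 →
    x' * t' ^ a * (x' * t' ^ b) * (x' * t' ^ c) * (x' * t' ^ d) = 1 →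
    ∃ f : E →* H, f t = t' ∧ f x = x'

namespace IsQuarticExtension

variable {n : ℕ} {a b c d : ℤ} {E : Type} [Group E] {t x : E}

theorem rotate (h : IsQuarticExtension n a b c d t x) : IsQuarticExtension n b c d a t x where
  pow_eq_one := h.pow_eq_one
  rel := mul_four_eq_one_rotate h.rel
  closure_eq_top := h.closure_eq_top
  exists_hom t' x' h1 h2 := h.exists_hom t' x' h1
    (mul_four_eq_one_rotate (mul_four_eq_one_rotate (mul_four_eq_one_rotate h2)))

/-- Tietze move: absorbing `t ^ e` into the generator lowers all four exponents by `e`, and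
exponents of `t` matter only modulo `n`. -/
theorem subst (h : IsQuarticExtension n a b c d t x) {a' b' c' d' : ℤ} (e : ℤ)
    (ha : a ≡ e + a' [ZMOD n]) (hb : b ≡ e + b' [ZMOD n]) (hc : c ≡ e + c' [ZMOD n])
    (hd : d ≡ e + d' [ZMOD n]) : IsQuarticExtension n a' b' c' d' t (x * t ^ e) := by
  have key : ∀ {H : Type} [Group H] {t x : H}, t ^ n = 1 → ∀ {u u' : ℤ}, u ≡ e + u' [ZMOD n] →
      x * t ^ u = x * t ^ e * t ^ u' := by
    intro H _ t x ht u u' hu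
    rw [zpow_eq_zpow_of_modEq ht hu, zpow_add, mul_assoc]
  refine ⟨h.pow_eq_one, ?_, ?_, fun {H} _ t' x' h1 h2 => ?_⟩
  · rw [← key h.pow_eq_one ha, ← key h.pow_eq_one hb, ← key h.pow_eq_one hc,
      ← key h.pow_eq_one hd, h.rel]
  · rw [eq_top_iff, ← h.closure_eq_top, Subgroup.closure_le]
    have ht : t ∈ Subgroup.closure {t, x * t ^ e} := Subgroup.subset_closure (by simp)
    rintro y (rfl | rfl)
    · exact ht
    · have : y * t ^ e ∈ Subgroup.closure {t, y * t ^ e} := Subgroup.subset_closure (by simp)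
      exact (Subgroup.mul_mem_cancel_right _ (Subgroup.zpow_mem _ ht e)).1 this
  · obtain ⟨f, hf1, hf2⟩ := h.exists_hom t' (x' * t' ^ (-e)) h1 (by
      rw [key h1 ha, key h1 hb, key h1 hc, key h1 hd]
      simpa using h2)
    exact ⟨f, hf1, by simp [hf1, hf2]⟩

end IsQuarticExtension

theorem shift_of (n : ℕ) (w : FreeGroup (ZMod n)) (i : ZMod n) :
    shift n w (PresentedGroup.of i) = PresentedGroup.of (i + 1) := by
  change PresentedGroup.mk _ (freeShift n (FreeGroup.of i)) = _
  simp [freeShift]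
  rfl

theorem shift_pow_of (n : ℕ) (w : FreeGroup (ZMod n)) (m : ℕ) (i : ZMod n) :
    (shift n w ^ m) (PresentedGroup.of i) = PresentedGroup.of (i + m) := by
  induction m with
  | zero => simp
  | succ m ih => rw [pow_succ', MulAut.mul_apply, ih, shift_of]; simp [add_assoc]

theorem shift_pow_self (n : ℕ) (w : FreeGroup (ZMod n)) : shift n w ^ n = 1 := by
  have h : (shift n w ^ n).toMonoidHom = MonoidHom.id _ := by
    ext i
    simp [shift_pow_of]
  ext y
  simpa using DFunLike.congr_fun h y

/-- The split extension of a cyclically presented group of length four by its shift. -/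
theorem exists_isQuarticExtension (n : ℕ) (hn : 0 < n) (j k l : ℤ) :
    ∃ (E : Type) (_ : Group E) (ι : CycGroup n (word n j k l) →* E)
      (π : E →* Multiplicative (ZMod n)) (t x : E),
      Function.Injective ι ∧ ι.range = π.ker ∧
      (∀ g, ι (shift n (word n j k l) g) = t * ι g * t⁻¹) ∧
      π t = Multiplicative.ofAdd 1 ∧ π x = 1 ∧
      IsQuarticExtension n j (k - j) (l - k) (-l) t x := by
  have : NeZero n := ⟨hn.ne'⟩
  set w := word n j k l with hw
  obtain ⟨φ, hφ⟩ := exists_multiplicative_zmod_hom (shift_pow_self n w)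
  let t : CycGroup n w ⋊[φ] Multiplicative (ZMod n) :=
    SemidirectProduct.inr (Multiplicative.ofAdd 1)
  let x : CycGroup n w ⋊[φ] Multiplicative (ZMod n) :=
    SemidirectProduct.inl (PresentedGroup.of 0)
  have hφ1 : φ (Multiplicative.ofAdd 1) = shift n w := by simpa using hφ 1
  have ht : ∀ i : ℤ, t ^ i = SemidirectProduct.inr (Multiplicative.ofAdd (i : ZMod n)) := by
    intro i
    rw [← map_zpow, ← ofAdd_zsmul]
    simp
  have hconj : ∀ i : ℤ, t ^ i * x * (t ^ i)⁻¹ =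
      SemidirectProduct.inl (PresentedGroup.of (i : ZMod n)) := by
    intro i
    rw [ht, ← map_inv, ← SemidirectProduct.inl_aut]
    congr 1
    obtain ⟨m, hm⟩ : ∃ m : ℕ, (m : ZMod n) = (i : ZMod n) := ⟨(i : ZMod n).val, by simp⟩
    have := hφ m
    rw [Int.cast_natCast, hm, zpow_natCast] at this
    rw [this, shift_pow_of, zero_add, hm]
  refine ⟨_, inferInstance, SemidirectProduct.inl, SemidirectProduct.rightHom, t, x,
    SemidirectProduct.inl_injective, SemidirectProduct.range_inl_eq_ker_rightHom, ?_, rfl, rfl,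
    ?_, ?_, ?_, ?_⟩
  · intro g
    rw [← hφ1, SemidirectProduct.inl_aut, map_inv]
  · rw [← map_pow, ← ofAdd_nsmul]
    simp
  · have h1 : (SemidirectProduct.inl (PresentedGroup.mk (relators n w) w) :
        CycGroup n w ⋊[φ] Multiplicative (ZMod n)) = 1 := by
      rw [(PresentedGroup.one_of_mem ⟨0, hn, by simp⟩ : PresentedGroup.mk (relators n w) w = 1),
        map_one]
    -- The conjugates of `x` by `t^0, t^j, t^k, t^l` telescope: only the differences of successive
    -- exponents survive.
    have h2 : (SemidirectProduct.inl (PresentedGroup.mk (relators n w) w) :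
        CycGroup n w ⋊[φ] Multiplicative (ZMod n)) = t ^ (0 : ℤ) * x * (t ^ (0 : ℤ))⁻¹ *
        (t ^ j * x * (t ^ j)⁻¹) * (t ^ k * x * (t ^ k)⁻¹) * (t ^ l * x * (t ^ l)⁻¹) := by
      rw [hconj, hconj, hconj, hconj, ← map_mul, ← map_mul, ← map_mul, Int.cast_zero]
      rfl
    rw [← h1, h2]
    simp only [zpow_sub, zpow_neg, zpow_zero]
    group
  · rw [eq_top_iff]
    rintro ⟨g, z⟩ -
    rw [SemidirectProduct.mk_eq_inl_mul_inr]
    have hT : t ∈ Subgroup.closure {t, x} := Subgroup.subset_closure (by simp)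
    have hX : x ∈ Subgroup.closure {t, x} := Subgroup.subset_closure (by simp)
    refine mul_mem ?_ ?_
    · have : (⊤ : Subgroup (CycGroup n w)) ≤
          (Subgroup.closure {t, x}).comap SemidirectProduct.inl := by
        rw [← PresentedGroup.closure_range_of, Subgroup.closure_le]
        rintro _ ⟨i, rfl⟩
        have := hconj (i.val : ℤ)
        rw [Int.cast_natCast, ZMod.natCast_zmod_val] at this
        change SemidirectProduct.inl (φ := φ) _ ∈ Subgroup.closure {t, x}
        rw [← this]
        exact mul_mem (mul_mem (zpow_mem hT _) hX) (inv_mem (zpow_mem hT _))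
      exact this (Subgroup.mem_top g)
    · have := ht (z.toAdd.val : ℤ)
      rw [Int.cast_natCast, ZMod.natCast_zmod_val] at this
      change SemidirectProduct.inr (φ := φ) (Multiplicative.ofAdd z.toAdd) ∈
        Subgroup.closure {t, x}
      rw [← this]
      exact zpow_mem hT _
  · intro H _ t' x' ht' hrel
    obtain ⟨F, hF⟩ := exists_multiplicative_zmod_hom ht'
    let f : ZMod n → H := fun i =>
      F (Multiplicative.ofAdd i) * x' * (F (Multiplicative.ofAdd i))⁻¹
    have hshift : ∀ (i : ℕ) (v : FreeGroup (ZMod n)), FreeGroup.lift f ((freeShift n ^ i) v) =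
        F (Multiplicative.ofAdd (i : ZMod n)) * FreeGroup.lift f v *
          (F (Multiplicative.ofAdd (i : ZMod n)))⁻¹ := by
      intro i v
      have : (FreeGroup.lift f).comp (freeShift n ^ i).toMonoidHom =
          (MulAut.conj (F (Multiplicative.ofAdd (i : ZMod n)))).toMonoidHom.comp
            (FreeGroup.lift f) := by
        ext p
        simp only [MonoidHom.comp_apply, MulEquiv.coe_toMonoidHom, freeShift_pow_of,
          FreeGroup.lift_apply_of, MulAut.conj_apply, f]
        rw [add_comm, ofAdd_add, map_mul]
        group
      exact DFunLike.congr_fun this v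
    have hwf : FreeGroup.lift f w = 1 := by
      simp only [hw, word, map_mul, FreeGroup.lift_apply_of, f, hF]
      rw [ofAdd_zero, map_one]
      refine Eq.trans ?_ hrel
      simp only [zpow_sub, zpow_neg]
      group
    have hrels : ∀ r ∈ relators n w, FreeGroup.lift f r = 1 := by
      rintro _ ⟨i, -, rfl⟩
      rw [hshift, hwf]
      simp
    refine ⟨SemidirectProduct.lift (PresentedGroup.toGroup hrels) F ?_, ?_, ?_⟩
    · intro z
      obtain ⟨m, rfl⟩ : ∃ m : ℕ, Multiplicative.ofAdd (m : ZMod n) = z :=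
        ⟨z.toAdd.val, by simp⟩
      have h1 : φ (Multiplicative.ofAdd (m : ZMod n)) = shift n w ^ m := by simpa using hφ m
      ext i
      simp only [MonoidHom.comp_apply, MulEquiv.coe_toMonoidHom, h1, shift_pow_of,
        PresentedGroup.toGroup.of, MulAut.conj_apply, f]
      rw [add_comm, ofAdd_add, map_mul]
      group
    · simp only [t, SemidirectProduct.lift_inr]
      simpa using hF 1
    · simp [x, f]

end CyclicPresentation

/-! ### Nontrivial secondary divisor: fixed points and infiniteness. -/

namespace CyclicPresentation

namespace IsQuarticExtension

variable {n : ℕ} {p : ℤ} {E : Type} [Group E] {t y : E}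

theorem map_zpow_eq {π : E →* Multiplicative (ZMod n)} (ht : π t = Multiplicative.ofAdd 1)
    (i : ℤ) : π (t ^ i) = Multiplicative.ofAdd (i : ZMod n) := by
  rw [map_zpow, ht, ← ofAdd_zsmul]
  simp

theorem zpow_eq_one_of_mem_ker (htn : t ^ n = 1) {π : E →* Multiplicative (ZMod n)}
    (ht : π t = Multiplicative.ofAdd 1) {i : ℤ} (hi : π (t ^ i) = 1) : t ^ i = 1 := by
  rw [map_zpow_eq ht, ofAdd_eq_one, ZMod.intCast_zmod_eq_zero_iff_dvd] at hi
  obtain ⟨c, rfl⟩ := hi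
  rw [zpow_mul, zpow_natCast, htn, one_zpow]

/-- Powers of `t` commute with `t`, so membership would give `t = t^(pm)`; applying `π` yields `pm ≡
1` modulo `n`, against the hypothesis on the gcd. -/
theorem conj_notMem_zpowers {π : E →* Multiplicative (ZMod n)} (ht : π t = Multiplicative.ofAdd 1)
    (hp : Int.gcd n p ≠ 1) : ∀ z ∈ Subgroup.zpowers t, z * t * z⁻¹ ∉ Subgroup.zpowers (t ^ p) := by
  rintro _ ⟨i, rfl⟩ ⟨m, hm⟩
  have h2 : π ((t ^ p) ^ m) = π (t ^ i * t * (t ^ i)⁻¹) := congrArg π hm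
  rw [← zpow_mul, map_zpow_eq ht, map_mul, map_mul, map_inv, mul_inv_cancel_comm, ht] at h2
  have h3 : ((p * m : ℤ) : ZMod n) = ((1 : ℤ) : ZMod n) := by
    simpa using Multiplicative.ofAdd.injective h2
  rw [ZMod.intCast_eq_intCast_iff_dvd_sub] at h3
  refine hp (Nat.dvd_one.1 (Int.natCast_dvd_natCast.1 ?_))
  have h4 : ((Int.gcd n p : ℕ) : ℤ) ∣ 1 - p * m := (Int.gcd_dvd_left _ _).trans h3
  have h5 : ((Int.gcd n p : ℕ) : ℤ) ∣ p * m := (Int.gcd_dvd_right _ _).mul_right m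
  simpa using dvd_add h4 h5

/-- The relation `t ^ n = 1` lives in one factor; as `p ∣ q`, the quartic relation involves only `y`
and powers of `t^p`, hence lives in the other. Both factors embed in `E`, where the relations can be
checked. A one-sided inverse suffices for computing centralizers. -/
theorem exists_amalgam_section {q : ℤ} (h : IsQuarticExtension n 0 0 p q t y) {e : ℤ}
    (hq : q = p * e) {G : Bool → Type} [∀ b, Group (G b)] {H : Type} [Group H]
    {φ : ∀ b, H →* G b} {f : ∀ b, G b →* E} {k : H →* E} (hf : ∀ b, (f b).comp (φ b) = k)
    (hinj : ∀ b, Function.Injective (f b)) {t₀ : G true} {y₀ : G false} {s₀ : H}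
    (ht : f true t₀ = t) (hy : f false y₀ = y) (hs : k s₀ = t ^ p) :
    ∃ F : E →* Monoid.PushoutI φ, F t = Monoid.PushoutI.of true t₀ ∧
      (Monoid.PushoutI.lift f k hf).comp F = MonoidHom.id E := by
  have hs1 : φ true s₀ = t₀ ^ p :=
    hinj true (by rw [map_zpow, ht, ← hs, ← hf true, MonoidHom.comp_apply])
  have hs2 : f false (φ false s₀) = t ^ p := by rw [← hs, ← hf false, MonoidHom.comp_apply]
  have hs' : (Monoid.PushoutI.of true t₀ : Monoid.PushoutI φ) ^ p =
      Monoid.PushoutI.of false (φ false s₀) := by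
    rw [← map_zpow, ← hs1, Monoid.PushoutI.of_apply_eq_base, Monoid.PushoutI.of_apply_eq_base]
  obtain ⟨F, hFt, hFy⟩ := h.exists_hom (Monoid.PushoutI.of true t₀ : Monoid.PushoutI φ)
    (Monoid.PushoutI.of false y₀) (by
      rw [← map_pow, ← map_one (Monoid.PushoutI.of true)]
      exact congrArg _ (hinj true (by rw [map_pow, ht, h.pow_eq_one, map_one]))) (by
      rw [hq, zpow_mul, hs', zpow_zero, mul_one, ← map_zpow, ← map_mul, ← map_mul, ← map_mul,
        ← map_mul, ← map_mul, ← map_one (Monoid.PushoutI.of false)]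
      refine congrArg _ (hinj false ?_)
      have := h.rel
      rw [hq, zpow_mul, zpow_zero, mul_one] at this
      simpa only [map_mul, map_zpow, map_one, hy, hs2] using this)
  refine ⟨F, hFt, MonoidHom.eqOn_closure_pair h.closure_eq_top ?_ ?_⟩
  · rw [MonoidHom.comp_apply, hFt, Monoid.PushoutI.lift_of, ht, MonoidHom.id_apply]
  · rw [MonoidHom.comp_apply, hFy, Monoid.PushoutI.lift_of, hy, MonoidHom.id_apply]

/-- The shift has no nontrivial fixed points when the secondary divisor is nontrivial. -/
theorem eq_one_of_commute {q : ℤ} (h : IsQuarticExtension n 0 0 p q t y) {e : ℤ} (hq : q = p * e)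
    {π : E →* Multiplicative (ZMod n)} (ht : π t = Multiplicative.ofAdd 1)
    (hp : Int.gcd n p ≠ 1) {g : E} (hg : g ∈ π.ker) (hgt : g * t = t * g) : g = 1 := by
  -- The factors are `⟨t⟩` and `⟨y, t^p⟩`, amalgamated along `⟨t^p⟩`.
  obtain ⟨S, hS1, hS2⟩ : ∃ S : Bool → Subgroup E,
      S true = Subgroup.zpowers t ∧ S false = Subgroup.closure {y, t ^ p} :=
    ⟨fun b => cond b (Subgroup.zpowers t) (Subgroup.closure {y, t ^ p}), rfl, rfl⟩
  have hC : ∀ b, Subgroup.zpowers (t ^ p) ≤ S b := by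
    rintro (_ | _)
    · rw [hS2, Subgroup.zpowers_le]
      exact Subgroup.subset_closure (by simp)
    · rw [hS1, Subgroup.zpowers_le]
      exact ⟨p, rfl⟩
  have htS : t ∈ S true := hS1 ▸ Subgroup.mem_zpowers t
  have hyS : y ∈ S false := hS2 ▸ Subgroup.subset_closure (by simp)
  have hf : ∀ b, (S b).subtype.comp (Subgroup.inclusion (hC b)) =
      (Subgroup.zpowers (t ^ p)).subtype := fun b => rfl
  obtain ⟨F, hFt, hF⟩ := h.exists_amalgam_section hq hf (fun b => (S b).subtype_injective)
    (t₀ := ⟨t, htS⟩) (y₀ := ⟨y, hyS⟩) (s₀ := ⟨t ^ p, Subgroup.mem_zpowers _⟩) rfl rfl rfl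
  obtain ⟨z, hz⟩ := Monoid.PushoutI.exists_eq_of_commute
    (fun b => Subgroup.inclusion_injective (hC b)) hf hF hFt (by
      rintro ⟨z, hz⟩ ⟨c, hc⟩
      have h1 : (c : E) = z * t * z⁻¹ := congrArg (S true).subtype hc
      exact conj_notMem_zpowers ht hp z (hS1 ▸ hz) (h1 ▸ c.2)) hgt
  have hgS : g ∈ Subgroup.zpowers t := by
    rw [← hS1, ← hz]
    exact z.2
  obtain ⟨i, rfl⟩ := hgS
  exact zpow_eq_one_of_mem_ker h.pow_eq_one ht hg

/-- Let `E` act on ℂ with `t` as multiplication by a root of unity `ζ` of exact order `gcd(n, p)`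
and `y` as `z ↦ 1 - z`. Then `t^p` and `t^q` act trivially and the relation reduces to `y^4 = 1`.
The commutator of `t` and `y` is translation by `ζ - 1 ≠ 0`, of infinite order. -/
theorem infinite_ker {q : ℤ} (h : IsQuarticExtension n 0 0 p q t y) {e : ℤ} (hq : q = p * e)
    (hn : 0 < n) (π : E →* Multiplicative (ZMod n)) (hp : Int.gcd n p ≠ 1) : Infinite π.ker := by
  have hγ : Int.gcd n p ≠ 0 := by
    rw [Ne, Int.gcd_eq_zero_iff]
    omega
  obtain ⟨ζ, hζ⟩ : ∃ ζ : ℂ, IsPrimitiveRoot ζ (Int.gcd n p) := ⟨_, Complex.isPrimitiveRoot_exp _ hγ⟩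
  have hζ1 : ζ ≠ 1 := fun h1 => hp (by rw [hζ.eq_orderOf, h1, orderOf_one])
  have hζ0 : ζ ≠ 0 := hζ.ne_zero hγ
  have hpow : ∀ i : ℤ, ((Equiv.mulLeft₀ ζ hζ0 : Equiv.Perm ℂ) ^ i) =
      Equiv.mulLeft₀ (ζ ^ i) (zpow_ne_zero _ hζ0) := by
    have hnat : ∀ i : ℕ, ((Equiv.mulLeft₀ ζ hζ0 : Equiv.Perm ℂ) ^ i) =
        Equiv.mulLeft₀ (ζ ^ i) (pow_ne_zero _ hζ0) := by
      intro i
      induction i with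
      | zero => ext z; simp
      | succ i ih => ext z; rw [pow_succ', Equiv.Perm.mul_apply, ih]; simp [pow_succ', mul_assoc]
    intro i
    obtain ⟨m, rfl | rfl⟩ := i.eq_nat_or_neg
    · rw [zpow_natCast, hnat]; ext z; simp
    · rw [zpow_neg, zpow_natCast, hnat, inv_eq_iff_mul_eq_one]
      ext z
      simp [hζ0]
  have hdvd : ∀ i : ℤ, ((Int.gcd n p : ℕ) : ℤ) ∣ i →
      ((Equiv.mulLeft₀ ζ hζ0 : Equiv.Perm ℂ) ^ i) = 1 := by
    intro i hi
    rw [hpow]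
    ext z
    simp [(hζ.zpow_eq_one_iff_dvd i).2 hi]
  have hpd : ((Int.gcd n p : ℕ) : ℤ) ∣ p := Int.gcd_dvd_right _ _
  obtain ⟨f, hft, hfy⟩ := h.exists_hom (Equiv.mulLeft₀ ζ hζ0 : Equiv.Perm ℂ)
    (Equiv.subLeft (1 : ℂ)) (by
      rw [← zpow_natCast]
      exact hdvd _ (Int.gcd_dvd_left _ _)) (by
      rw [hq, hdvd _ hpd, hdvd _ (hpd.mul_right e)]
      ext z
      simp)
  let c : π.ker := ⟨t * y * t⁻¹ * y⁻¹, by simp [MonoidHom.mem_ker]⟩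
  have hc : ∀ z, f c z = z + (ζ - 1) := by
    intro z
    simp only [c, map_mul, map_inv, hft, hfy, Equiv.Perm.mul_apply]
    have h1 : (Equiv.subLeft (1 : ℂ) : Equiv.Perm ℂ)⁻¹ z = 1 - z := by
      rw [Equiv.Perm.inv_eq_iff_eq]; simp
    have h2 : ∀ v, (Equiv.mulLeft₀ ζ hζ0 : Equiv.Perm ℂ)⁻¹ v = ζ⁻¹ * v := by
      intro v
      rw [Equiv.Perm.inv_eq_iff_eq]; simp [hζ0]
    rw [h1, h2]
    simp only [Equiv.subLeft_apply, Equiv.mulLeft₀_apply]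
    field_simp
    ring
  have hcm : ∀ m : ℕ, f ((c ^ m : π.ker) : E) 0 = m * (ζ - 1) := by
    intro m
    induction m with
    | zero => simp
    | succ m ih =>
      rw [pow_succ', Subgroup.coe_mul, map_mul, Equiv.Perm.mul_apply, ih, hc]
      push_cast
      ring
  refine Infinite.of_injective (fun m : ℕ => c ^ m) fun a b hab => ?_
  have := congrArg (fun u : π.ker => f (u : E) 0) hab
  simp only [hcm] at this
  exact_mod_cast mul_right_cancel₀ (sub_ne_zero.2 hζ1) this

end IsQuarticExtension
end CyclicPresentation

/-! ### Finiteness, metacyclicity and solvability criteria. -/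

namespace CyclicPresentation

/-- A group generated by two elements of finite order, one of which generates a normal subgroup,
is finite. -/
theorem finite_of_normal_zpowers {E : Type*} [Group E] {a b : E}
    (hab : Subgroup.closure {a, b} = ⊤) (ha : IsOfFinOrder a) (hb : IsOfFinOrder b)
    [hN : (Subgroup.zpowers a).Normal] : Finite E := by
  have : Finite (Subgroup.zpowers a) := finite_zpowers.2 ha
  have : Finite (Subgroup.zpowers b) := finite_zpowers.2 hb
  refine Finite.of_surjective
    (fun u : Subgroup.zpowers a × Subgroup.zpowers b => (u.1 : E) * u.2) fun g => ?_
  have hg : g ∈ Subgroup.zpowers a ⊔ Subgroup.zpowers b := by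
    have : g ∈ Subgroup.closure {a, b} := hab ▸ Subgroup.mem_top g
    rwa [Set.insert_eq, Subgroup.closure_union, ← Subgroup.zpowers_eq_closure,
      ← Subgroup.zpowers_eq_closure] at this
  obtain ⟨u, hu, v, hv, rfl⟩ := Subgroup.mem_sup_of_normal_left.1 hg
  exact ⟨(⟨u, hu⟩, ⟨v, hv⟩), rfl⟩

/-- If `a` has finite order then `⟨a⟩` is normal as soon as the generators of the group conjugate
`a` into `⟨a⟩`. -/
theorem normal_zpowers_of_conj_mem {E : Type*} [Group E] {a : E} {s : Set E}
    (hs : Subgroup.closure s = ⊤) (ha : IsOfFinOrder a)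
    (h : ∀ g ∈ s, g * a * g⁻¹ ∈ Subgroup.zpowers a) : (Subgroup.zpowers a).Normal := by
  have : Finite (Subgroup.zpowers a) := finite_zpowers.2 ha
  rw [← Subgroup.normalizer_eq_top_iff, eq_top_iff, ← hs, Subgroup.closure_le]
  intro g hg
  have h1 : (Subgroup.zpowers a).map (MulAut.conj g).toMonoidHom ≤ Subgroup.zpowers a := by
    rw [MonoidHom.map_zpowers, Subgroup.zpowers_le]
    exact h g hg
  -- Finiteness turns the inclusion into an equality by counting, so inverses of the generators need
  -- no separate check.
  have h2 : (Subgroup.zpowers a).map (MulAut.conj g).toMonoidHom = Subgroup.zpowers a :=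
    Subgroup.eq_of_le_of_card_ge h1 (by
      rw [Nat.card_congr ((Subgroup.zpowers a).equivMapOfInjective (MulAut.conj g).toMonoidHom
        (MulAut.conj g).injective).toEquiv])
  rw [SetLike.mem_coe, Subgroup.mem_normalizer_iff]
  intro u
  nth_rw 2 [← h2]
  constructor
  · exact fun hu => ⟨u, hu, rfl⟩
  · rintro ⟨v, hv, hv'⟩
    have : v = u := (MulAut.conj g).injective hv'
    exact this ▸ hv

theorem IsMetacyclic.of_injective {G E : Type*} [Group G] [Group E] {f : G →* E}
    (hf : Function.Injective f) (hE : IsMetacyclic E) : IsMetacyclic G := by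
  obtain ⟨N, hN, h1, h2⟩ := hE
  refine ⟨N.comap f, inferInstance, ?_, ?_⟩
  · refine isCyclic_of_injective (f.subgroupComap N) fun a b hab => ?_
    exact Subtype.ext (hf (congrArg (fun u : N => (u : E)) hab))
  · refine isCyclic_of_injective (QuotientGroup.map (N.comap f) N f le_rfl) ?_
    rw [← MonoidHom.ker_eq_bot_iff, QuotientGroup.ker_map]
    exact (QuotientGroup.map_mk'_self _)

theorem IsMetacyclic.isSolvable {G : Type*} [Group G] (hG : IsMetacyclic G) :
    Group.IsSolvable G := by
  obtain ⟨N, hN, h1, h2⟩ := hG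
  have : Group.IsSolvable N := by
    let := IsCyclic.commGroup (α := N)
    exact Group.isSolvable_of_comm mul_comm
  have : Group.IsSolvable (G ⧸ N) := by
    let := IsCyclic.commGroup (α := G ⧸ N)
    exact Group.isSolvable_of_comm mul_comm
  exact (Group.isSolvable_iff_subgroup_quotient N).2 ⟨inferInstance, inferInstance⟩

theorem isSolvable_dihedralGroup (m : ℕ) : Group.IsSolvable (DihedralGroup m) := by
  let f : DihedralGroup m →* Multiplicative (ZMod 2) := MonoidHom.mk'
    (fun g => match g with
      | .r _ => Multiplicative.ofAdd 0
      | .sr _ => Multiplicative.ofAdd 1) (by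
    rintro (a | a) (b | b)
    exacts [rfl, rfl, rfl, (by decide : Multiplicative.ofAdd (0 : ZMod 2) =
      Multiplicative.ofAdd 1 * Multiplicative.ofAdd 1)])
  have : Group.IsSolvable f.ker := by
    refine Group.isSolvable_of_comm ?_
    rintro ⟨a | a, ha⟩ ⟨b | b, hb⟩
    · exact Subtype.ext (by simp [add_comm])
    all_goals exact absurd (Multiplicative.ofAdd.injective ‹_› : (1 : ZMod 2) = 0) (by decide)
  exact Group.isSolvable_of_ker_le_range f.ker.subtype f (by simp)

theorem IsCyclicCentralExtensionOfDihedral.isSolvable {G : Type*} [Group G]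
    (hG : IsCyclicCentralExtensionOfDihedral G) : Group.IsSolvable G := by
  obtain ⟨m, f, -, -, -, h⟩ := hG
  have : Group.IsSolvable f.ker := by
    let := IsCyclic.commGroup (α := f.ker)
    exact Group.isSolvable_of_comm mul_comm
  have := isSolvable_dihedralGroup m
  exact Group.isSolvable_of_ker_le_range f.ker.subtype f (by simp)

/-- Used to read off integer powers in explicit one-parameter families of permutations. -/
theorem zpow_eq_of_map_add {K : Type*} [Group K] {P : ℤ → K}
    (hP : ∀ a b, P (a + b) = P a * P b) (k : ℤ) : P 1 ^ k = P k := by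
  let f : Multiplicative ℤ →* K := MonoidHom.mk' (fun a => P a.toAdd) fun a b => hP _ _
  have h : f (Multiplicative.ofAdd 1) ^ k = f (Multiplicative.ofAdd k) := by
    rw [← map_zpow, ← ofAdd_zsmul]
    simp
  exact h

/-- A function on `ℤ/n` that is multiplied by `μ` under translation by `p`. -/
theorem exists_semiinvariant {n : ℕ} [NeZero n] (p : ZMod n) {R : Type*} [CommRing R] {μ : R}
    (hμ : μ ^ addOrderOf p = 1) : ∃ f : ZMod n → R, f 0 = 1 ∧ ∀ i, f (i + p) = μ * f i := by
  classical
  have hpos : 0 < addOrderOf p := (isOfFinAddOrder_of_finite p).addOrderOf_pos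
  -- The function is `μ ^ a` at `a • p` and zero off the subgroup generated by `p`; the hypothesis
  -- on `μ` makes the choice of `a` immaterial.
  let f : ZMod n → R := fun i => if h : ∃ a : ℕ, i = a • p then μ ^ h.choose else 0
  have hf : ∀ a : ℕ, f (a • p) = μ ^ a := by
    intro a
    have h : ∃ b : ℕ, a • p = b • p := ⟨a, rfl⟩
    have h1 : h.choose ≡ a [MOD addOrderOf p] := nsmul_eq_nsmul_iff_modEq.1 h.choose_spec.symm
    simp only [f, dif_pos h]
    rw [pow_eq_pow_mod _ hμ, h1, ← pow_eq_pow_mod _ hμ]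
  refine ⟨f, by simpa using hf 0, fun i => ?_⟩
  by_cases h : ∃ a : ℕ, i = a • p
  · obtain ⟨a, rfl⟩ := h
    rw [← succ_nsmul, hf, hf, pow_succ']
  · have h' : ¬ ∃ a : ℕ, i + p = a • p := by
      rintro ⟨a, ha⟩
      refine h ⟨a + (addOrderOf p - 1), ?_⟩
      rw [add_nsmul, ← ha, add_assoc, ← succ_nsmul', Nat.sub_add_cancel hpos,
        addOrderOf_nsmul_eq_zero, add_zero]
    have h1 : f i = 0 := dif_neg h
    have h2 : f (i + p) = 0 := dif_neg h'
    rw [h1, h2, mul_zero]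

/-! ### The metacyclic family, with exponents `0, 0, p, -p`. -/

namespace IsQuarticExtension

variable {n : ℕ} {p : ℤ} {E : Type} [Group E] {t y : E}

theorem exists_pow_eq_of_gcd_eq_one (ht : t ^ n = 1) (hn : 0 < n) (hp : Int.gcd n p = 1) :
    ∃ e : ℕ, (t ^ p) ^ e = t := by
  have h := Int.gcd_eq_gcd_ab n p
  rw [hp] at h
  have h1 : p * Int.gcdB n p = 1 - n * Int.gcdA n p := by push_cast at h; linarith
  have h2 : (t ^ p) ^ Int.gcdB n p = t := by
    rw [← zpow_mul, h1, zpow_sub, zpow_mul, zpow_natCast, ht]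
    simp
  have h3 : (t ^ p) ^ n = 1 := by
    rw [← zpow_natCast, ← zpow_mul, mul_comm, zpow_mul, zpow_natCast, ht, one_zpow]
  -- The Bézout coefficient is reduced modulo `n` to obtain a natural exponent.
  refine ⟨(Int.gcdB n p % n).toNat, ?_⟩
  rw [← zpow_natCast, Int.toNat_of_nonneg (Int.emod_nonneg _ (by omega)),
    zpow_eq_zpow_of_modEq h3 (Int.mod_modEq _ _), h2]

theorem isOfFinOrder_left {a b c d : ℤ} (h : IsQuarticExtension n a b c d t y) (hn : 0 < n) :
    IsOfFinOrder t :=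
  isOfFinOrder_iff_pow_eq_one.2 ⟨n, hn, h.pow_eq_one⟩

section Metacyclic

theorem conj_eq (h : IsQuarticExtension n 0 0 p (-p) t y) :
    t ^ p * y * (t ^ p)⁻¹ = y ^ (-3 : ℤ) := by
  have h1 := h.rel
  simp only [zpow_zero, mul_one, zpow_neg] at h1
  have h2 : y * y * y * (t ^ p * y * (t ^ p)⁻¹) = 1 := by
    rw [← h1]
    simp only [mul_assoc]
  rw [mul_eq_one_iff_eq_inv'] at h2
  rw [h2]
  group

theorem conj_pow_eq (h : IsQuarticExtension n 0 0 p (-p) t y) (k : ℕ) :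
    (t ^ p) ^ k * y * ((t ^ p) ^ k)⁻¹ = y ^ ((-3 : ℤ) ^ k) := by
  induction k with
  | zero => simp
  | succ k ih =>
    rw [pow_succ, mul_inv_rev, mul_assoc (_ ^ k), mul_assoc (_ ^ k),
      show t ^ p * y * ((t ^ p)⁻¹ * ((t ^ p) ^ k)⁻¹) =
        t ^ p * y * (t ^ p)⁻¹ * ((t ^ p) ^ k)⁻¹ by group, h.conj_eq, ← mul_assoc, ← conj_zpow, ih,
      ← zpow_mul, pow_succ]

/-- Conjugation by `t^p` raises `y` to the power `-3`, and with `r` the order of `p` modulo `n` one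
has `(t^p)^r = 1`; hence `y = y^((-3)^r)`. -/
theorem zpow_addOrderOf (h : IsQuarticExtension n 0 0 p (-p) t y) :
    y ^ ((-3 : ℤ) ^ addOrderOf (p : ZMod n) - 1) = 1 := by
  have hs : (t ^ p) ^ addOrderOf (p : ZMod n) = 1 := by
    have h1 : ((p * addOrderOf (p : ZMod n) : ℤ) : ZMod n) = 0 := by
      have := addOrderOf_nsmul_eq_zero (p : ZMod n)
      rw [nsmul_eq_mul, mul_comm] at this
      exact_mod_cast this
    rw [ZMod.intCast_zmod_eq_zero_iff_dvd] at h1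
    obtain ⟨c, hc⟩ := h1
    rw [← zpow_natCast, ← zpow_mul, hc, zpow_mul, zpow_natCast, h.pow_eq_one, one_zpow]
  have := h.conj_pow_eq (addOrderOf (p : ZMod n))
  rw [hs] at this
  rw [zpow_sub, ← this]
  simp

/-- Represent `E` on `ℤ/n × ℤ/N`, with `N = |(-3)^r - 1|`: `t` translates the first coordinate and
`y` adds `f(i)` to the second over `i`. The relation becomes `f(i - p) = -3 f(i)`, solvable because
`(-3)^r = 1` modulo `N`. Evaluating at `(0, 0)`, where `f(0) = 1`, bounds the order of `y` below
even modulo powers of `t`. -/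
theorem dvd_of_zpow_eq (h : IsQuarticExtension n 0 0 p (-p) t y) (hn : 0 < n) {k m : ℤ}
    (hkm : y ^ k = t ^ m) : (-3 : ℤ) ^ addOrderOf (p : ZMod n) - 1 ∣ k := by
  have : NeZero n := ⟨hn.ne'⟩
  set N := ((-3 : ℤ) ^ addOrderOf (p : ZMod n) - 1).natAbs with hN
  have hμ : (-3 : ZMod N) ^ addOrderOf (p : ZMod n) = 1 := by
    have h1 : (((-3 : ℤ) ^ addOrderOf (p : ZMod n) - 1 : ℤ) : ZMod N) = 0 := by
      rw [ZMod.intCast_zmod_eq_zero_iff_dvd, hN, Int.natAbs_dvd]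
    push_cast at h1
    exact sub_eq_zero.1 h1
  obtain ⟨f, hf0, hf⟩ := exists_semiinvariant (-p : ZMod n) (by rwa [addOrderOf_neg])
  let T : ℤ → Equiv.Perm (ZMod n × ZMod N) := fun a =>
    ⟨fun u => (u.1 + a, u.2), fun u => (u.1 - a, u.2), fun u => by simp, fun u => by simp⟩
  let Y : ℤ → Equiv.Perm (ZMod n × ZMod N) := fun a =>
    ⟨fun u => (u.1, u.2 + a * f u.1), fun u => (u.1, u.2 - a * f u.1), fun u => by simp,
      fun u => by simp⟩
  have hT : ∀ a : ℤ, T 1 ^ a = T a := zpow_eq_of_map_add fun a b => by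
    ext u <;> simp [T]; ring
  have hY : ∀ a : ℤ, Y 1 ^ a = Y a := zpow_eq_of_map_add fun a b => by
    ext u <;> simp [Y]; ring
  obtain ⟨F, hFt, hFy⟩ := h.exists_hom (T 1) (Y 1)
    (by rw [← zpow_natCast, hT]; ext u <;> simp [T]) (by
      simp only [hT]
      ext u
      · simp [T, Y]
      · have := hf u.1
        simp only [T, Y, Equiv.Perm.mul_apply, Equiv.coe_fn_mk]
        push_cast
        simp only [add_zero, one_mul, this, id_eq]
        ring_nf)
  have h1 := congrArg (fun v => (F v (0, 0)).2) hkm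
  simp only [map_zpow, hFt, hFy, hT, hY, T, Y, Equiv.coe_fn_mk, hf0] at h1
  rw [← Int.natAbs_dvd, ← hN, ← ZMod.intCast_zmod_eq_zero_iff_dvd]
  simpa using h1

theorem two_le_addOrderOf {n : ℕ} (hn : 0 < n) {p : ℤ} (hp : ¬ (n : ℤ) ∣ p) :
    2 ≤ addOrderOf (p : ZMod n) := by
  have : NeZero n := ⟨hn.ne'⟩
  have h1 : 0 < addOrderOf (p : ZMod n) := (isOfFinAddOrder_of_finite _).addOrderOf_pos
  have h2 : addOrderOf (p : ZMod n) ≠ 1 := by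
    rw [Ne, AddMonoid.addOrderOf_eq_one_iff, ZMod.intCast_zmod_eq_zero_iff_dvd]
    exact hp
  omega

theorem eight_le_natAbs {r : ℕ} (hr : 2 ≤ r) : 8 ≤ ((-3 : ℤ) ^ r - 1).natAbs := by
  have h1 : ((-3 : ℤ) ^ r).natAbs = 3 ^ r := by simp [Int.natAbs_pow]
  have h2 : 3 ^ 2 ≤ 3 ^ r := Nat.pow_le_pow_right (by norm_num) hr
  omega

theorem four_dvd (r : ℕ) : (4 : ℤ) ∣ (-3 : ℤ) ^ r - 1 := by
  have := sub_dvd_pow_sub_pow (-3 : ℤ) 1 r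
  rw [one_pow] at this
  exact (by norm_num : (4 : ℤ) ∣ -3 - 1).trans this

variable {π : E →* Multiplicative (ZMod n)}

theorem isOfFinOrder_right (h : IsQuarticExtension n 0 0 p (-p) t y) (hn : 0 < n)
    (hp : ¬ (n : ℤ) ∣ p) : IsOfFinOrder y := by
  rw [isOfFinOrder_iff_zpow_eq_one]
  refine ⟨_, ?_, h.zpow_addOrderOf⟩
  have := eight_le_natAbs (two_le_addOrderOf hn hp)
  omega

/-- The witness is `y^4`. Applying `π` to the relation cancels the powers of `t`, so `y^4` lies in
the kernel; it is nontrivial since a number of absolute value at least 8 cannot divide 4. -/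
theorem exists_torsion (h : IsQuarticExtension n 0 0 p (-p) t y) (hn : 0 < n)
    (hp : ¬ (n : ℤ) ∣ p) : ∃ g ∈ π.ker, g ≠ 1 ∧ IsOfFinOrder g := by
  refine ⟨y ^ 4, ?_, fun h4 => ?_, (h.isOfFinOrder_right hn hp).pow⟩
  · have := congrArg π h.rel
    simp only [zpow_zero, mul_one, map_mul, map_one, zpow_neg, map_inv] at this
    rw [MonoidHom.mem_ker, map_pow, ← this, mul_assoc (π y * π y), mul_mul_mul_comm (π y) _ (π y),
      mul_inv_cancel, mul_one]
    simp only [pow_succ, pow_zero, one_mul, mul_assoc]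
  · have h1 := h.dvd_of_zpow_eq hn (k := 4) (m := 0) (by rw [zpow_zero]; exact_mod_cast h4)
    have h2 := eight_le_natAbs (two_le_addOrderOf hn hp)
    have h3 := Int.le_of_dvd (by norm_num) (Int.natAbs_dvd.2 h1)
    omega

/-- Take `m = ((-3)^r - 1) / 4`. Then `y^(-3m) = y^m`, because `y^(4m) = 1`, so `y^m` commutes with
`t^p`; the factor `t^(-am)` moves it into the kernel of `π`. Triviality would force `4m ∣ m`. -/
theorem exists_commute (h : IsQuarticExtension n 0 0 p (-p) t y) (hn : 0 < n)
    (hp : ¬ (n : ℤ) ∣ p) (ht : π t = Multiplicative.ofAdd 1) {a : ℤ}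
    (hy : π y = Multiplicative.ofAdd (a : ZMod n)) :
    ∃ g ∈ π.ker, g ≠ 1 ∧ Commute g (t ^ p) := by
  obtain ⟨m, hm⟩ := four_dvd (addOrderOf (p : ZMod n))
  have h8 := eight_le_natAbs (two_le_addOrderOf hn hp)
  refine ⟨y ^ m * t ^ (-(a * m)), ?_, fun h1 => ?_, ?_⟩
  · rw [MonoidHom.mem_ker, map_mul, map_zpow_eq ht, map_zpow, hy, ← ofAdd_zsmul, ← ofAdd_add,
      ofAdd_eq_one]
    push_cast
    rw [zsmul_eq_mul]
    ring
  · have h2 := h.dvd_of_zpow_eq hn (k := m) (m := a * m) (by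
      rw [mul_eq_one_iff_eq_inv, zpow_neg, inv_inv] at h1
      exact h1)
    rw [hm] at h2 h8
    obtain ⟨c, hc⟩ := h2
    have h3 : m * (4 * c - 1) = 0 := by linarith
    rcases mul_eq_zero.1 h3 with h4 | h4
    · simp [h4] at h8
    · omega
  · refine Commute.mul_left ?_ ((Commute.refl t).zpow_zpow _ _)
    have h1 := congrArg (· ^ m) h.conj_eq
    simp only [conj_zpow] at h1
    have h2 := h.zpow_addOrderOf
    rw [hm] at h2
    have h3 : (y ^ (-3 : ℤ)) ^ m = y ^ m := by
      rw [← zpow_mul, ← one_mul (y ^ (-3 * m)), ← h2, ← zpow_add]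
      congr 1
      ring
    rw [h3, mul_inv_eq_iff_eq_mul] at h1
    exact h1.symm

theorem normal_zpowers (h : IsQuarticExtension n 0 0 p (-p) t y) (hn : 0 < n)
    (hp : ¬ (n : ℤ) ∣ p) (hgcd : Int.gcd n p = 1) : (Subgroup.zpowers y).Normal := by
  refine normal_zpowers_of_conj_mem h.closure_eq_top (h.isOfFinOrder_right hn hp) ?_
  rintro g (rfl | rfl)
  -- Since `t` is a power of `t^p`, conjugation by `t` also sends `y` to a power of itself.
  · obtain ⟨e, he⟩ := exists_pow_eq_of_gcd_eq_one h.pow_eq_one hn hgcd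
    have := h.conj_pow_eq e
    rw [he] at this
    exact ⟨_, this.symm⟩
  · simp

theorem finite_of_gcd_eq_one (h : IsQuarticExtension n 0 0 p (-p) t y) (hn : 0 < n)
    (hp : ¬ (n : ℤ) ∣ p) (hgcd : Int.gcd n p = 1) : Finite E := by
  have := h.normal_zpowers hn hp hgcd
  exact finite_of_normal_zpowers (by rw [Set.pair_comm]; exact h.closure_eq_top)
    (h.isOfFinOrder_right hn hp) (h.isOfFinOrder_left hn)

theorem isMetacyclic_of_gcd_eq_one (h : IsQuarticExtension n 0 0 p (-p) t y) (hn : 0 < n)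
    (hp : ¬ (n : ℤ) ∣ p) (hgcd : Int.gcd n p = 1) : IsMetacyclic E := by
  have := h.normal_zpowers hn hp hgcd
  refine ⟨Subgroup.zpowers y, this, inferInstance, ?_⟩
  rw [isCyclic_iff_exists_zpowers_eq_top]
  refine ⟨QuotientGroup.mk' _ t, ?_⟩
  have h1 := congrArg (Subgroup.map (QuotientGroup.mk' (Subgroup.zpowers y))) h.closure_eq_top
  rw [MonoidHom.map_closure, Set.image_pair, Subgroup.map_top_of_surjective _
    (QuotientGroup.mk'_surjective _)] at h1
  have h2 : QuotientGroup.mk' (Subgroup.zpowers y) y = 1 :=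
    (QuotientGroup.eq_one_iff y).2 (Subgroup.mem_zpowers y)
  rw [eq_top_iff, ← h1, Subgroup.closure_le]
  rintro g (rfl | rfl)
  · exact Subgroup.mem_zpowers _
  · rw [h2]
    exact one_mem _

end Metacyclic

end IsQuarticExtension
end CyclicPresentation

/-! ### The dihedral family, with exponents `0, 0, p, p`. -/

namespace CyclicPresentation
namespace IsQuarticExtension

variable {n : ℕ} {p : ℤ} {E : Type} [Group E] {t y : E}

section Dihedral

theorem sq_mul_sq (h : IsQuarticExtension n 0 0 p p t y) :
    y ^ 2 * (y * t ^ p) ^ 2 = 1 := by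
  have := h.rel
  simp only [zpow_zero, mul_one] at this
  rw [← this]
  simp only [pow_two, mul_assoc]

/-- By the relation `y^2 = (y t^p)^(-2)`, so `y^2` commutes with both `y` and `y t^p`. -/
theorem commute_sq (h : IsQuarticExtension n 0 0 p p t y) : Commute (y ^ 2) (t ^ p) := by
  have h1 : Commute (y ^ 2) (y * t ^ p) := by
    rw [eq_inv_of_mul_eq_one_left h.sq_mul_sq]
    exact ((Commute.refl (y * t ^ p)).pow_left 2).inv_left
  have h2 : Commute (y ^ 2) y⁻¹ := ((Commute.refl y).pow_left 2).inv_right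
  simpa using h2.mul_right h1

/-- The relation gives `y t^p y⁻¹ = y^(-4) t^(-p)`; powers are then taken factorwise because `y^2`
commutes with `t^p`. -/
theorem conj_zpow_eq (h : IsQuarticExtension n 0 0 p p t y) (e : ℤ) :
    y * (t ^ p) ^ e * y⁻¹ = (y ^ 2) ^ (-(2 * e)) * (t ^ p) ^ (-e) := by
  have h1 : y * t ^ p * y⁻¹ = (y ^ 2) ^ (-2 : ℤ) * (t ^ p)⁻¹ := by
    have h2 := h.sq_mul_sq
    have h3 := h.commute_sq
    rw [mul_eq_one_iff_eq_inv', pow_two, ← mul_assoc, ← eq_mul_inv_iff_mul_eq,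
      ← eq_mul_inv_iff_mul_eq] at h2
    have h4 : (y ^ 2) ^ (-2 : ℤ) = (y ^ 2)⁻¹ * (y ^ 2)⁻¹ := by group
    have h5 : y⁻¹ * y⁻¹ = (y ^ 2)⁻¹ := by rw [pow_two, mul_inv_rev]
    rw [h2, h4, mul_assoc, mul_assoc, mul_assoc, h5, h3.inv_left.inv_right.eq]
  rw [← conj_zpow, h1, ((h.commute_sq.zpow_left (-2)).inv_right).mul_zpow, ← zpow_mul, inv_zpow,
    zpow_neg (t ^ p)]
  congr 2
  ring

theorem commutator_eq (h : IsQuarticExtension n 0 0 p p t y) :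
    y * t ^ p * y⁻¹ * (t ^ p)⁻¹ = (y ^ 2) ^ (-2 : ℤ) * (t ^ p) ^ (-2 : ℤ) := by
  have := h.conj_zpow_eq 1
  rw [zpow_one] at this
  rw [this, mul_assoc]
  congr 1
  group

theorem zpow_pow_eq_one (h : IsQuarticExtension n 0 0 p p t y) : (t ^ p) ^ n = 1 := by
  rw [← zpow_natCast, ← zpow_mul, mul_comm, zpow_mul, zpow_natCast, h.pow_eq_one, one_zpow]

theorem sq_zpow_eq_one (h : IsQuarticExtension n 0 0 p p t y) : (y ^ 2) ^ (2 * n : ℤ) = 1 := by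
  -- At exponent `n` both powers of `t^p` vanish, leaving `y^(-4n) = 1`.
  have h1 := h.conj_zpow_eq n
  rw [zpow_neg (t ^ p), zpow_natCast (t ^ p), h.zpow_pow_eq_one] at h1
  simpa using h1.symm

theorem isOfFinOrder_sq (h : IsQuarticExtension n 0 0 p p t y) (hn : 0 < n) :
    IsOfFinOrder (y ^ 2) :=
  isOfFinOrder_iff_zpow_eq_one.2 ⟨2 * n, by omega, h.sq_zpow_eq_one⟩

/-- Represent `E` on two copies of ℤ/2n: `t` adds 2 on the `true` copy and fixes the other, while
`y` swaps the copies, subtracting `p` on leaving `true`. At `(false, 0)` the two products differ by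
`2p`, which vanishes modulo `2n` only if `n ∣ p`. -/
theorem not_commute (h : IsQuarticExtension n 0 0 p p t y) (hp : ¬ (n : ℤ) ∣ p) :
    y * t ^ p ≠ t ^ p * y := by
  intro hcomm
  let T : ℤ → Equiv.Perm (Bool × ZMod (2 * n)) := fun a =>
    ⟨fun u => (u.1, u.2 + if u.1 then 2 * (a : ZMod (2 * n)) else 0),
      fun u => (u.1, u.2 - if u.1 then 2 * (a : ZMod (2 * n)) else 0),
      fun u => by simp, fun u => by simp⟩
  let Y : Equiv.Perm (Bool × ZMod (2 * n)) :=
    ⟨fun u => (!u.1, u.2 - if u.1 then (p : ZMod (2 * n)) else 0),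
      fun u => (!u.1, u.2 + if u.1 then 0 else (p : ZMod (2 * n))),
      fun u => by rcases u with ⟨_ | _, u⟩ <;> simp, fun u => by rcases u with ⟨_ | _, u⟩ <;> simp⟩
  have hT : ∀ a : ℤ, T 1 ^ a = T a := zpow_eq_of_map_add fun a b => by
    ext ⟨_ | _, u⟩ <;> simp [T]; ring
  have hn2 : (2 : ZMod (2 * n)) * n = 0 := by
    have := ZMod.natCast_self (2 * n)
    exact_mod_cast this
  obtain ⟨F, hFt, hFy⟩ := h.exists_hom (T 1) Y
    (by rw [← zpow_natCast, hT]; ext ⟨_ | _, u⟩ <;> simp [T, hn2]) (by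
      simp only [hT]
      ext ⟨_ | _, u⟩ <;> simp [T, Y] <;> ring)
  have h1 := congrArg (fun v => (F v (false, 0)).2) hcomm
  simp only [map_mul, map_zpow, hFt, hFy, hT, T, Y, Equiv.coe_fn_mk, Equiv.Perm.mul_apply] at h1
  have h2 : ((2 * p : ℤ) : ZMod (2 * n)) = 0 := by
    push_cast
    simpa using h1.symm
  rw [ZMod.intCast_zmod_eq_zero_iff_dvd] at h2
  push_cast at h2
  exact hp ((mul_dvd_mul_iff_left two_ne_zero).1 h2)

variable {π : E →* Multiplicative (ZMod n)}

/-- The commutator of `y` and `t^p` is killed by the abelian quotient `π`, and equals `y^(-4)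
t^(-2p)`, a product of commuting elements of finite order that both commute with `t^p`. -/
theorem exists_torsion_commute (h : IsQuarticExtension n 0 0 p p t y) (hn : 0 < n)
    (hp : ¬ (n : ℤ) ∣ p) :
    ∃ g ∈ π.ker, g ≠ 1 ∧ IsOfFinOrder g ∧ Commute g (t ^ p) := by
  refine ⟨y * t ^ p * y⁻¹ * (t ^ p)⁻¹, ?_, fun h1 => ?_, ?_, ?_⟩
  · simp [MonoidHom.mem_ker]
  · refine h.not_commute hp ?_
    rwa [mul_inv_eq_one, mul_inv_eq_iff_eq_mul] at h1
  · rw [h.commutator_eq]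
    have h1 : Commute ((y ^ 2) ^ (-2 : ℤ)) ((t ^ p) ^ (-2 : ℤ)) := h.commute_sq.zpow_zpow _ _
    exact h1.isOfFinOrder_mul (h.isOfFinOrder_sq hn).zpow
      (isOfFinOrder_iff_pow_eq_one.2 ⟨n, hn, h.zpow_pow_eq_one⟩).zpow
  · rw [h.commutator_eq]
    exact (h.commute_sq.zpow_left _).mul_left ((Commute.refl _).zpow_left _)

theorem commute_sq_left (h : IsQuarticExtension n 0 0 p p t y) (hn : 0 < n)
    (hgcd : Int.gcd n p = 1) : Commute (y ^ 2) t := by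
  obtain ⟨e, he⟩ := exists_pow_eq_of_gcd_eq_one h.pow_eq_one hn hgcd
  rw [← he]
  exact h.commute_sq.pow_right e

theorem sq_mem_center (h : IsQuarticExtension n 0 0 p p t y) (hn : 0 < n)
    (hgcd : Int.gcd n p = 1) : y ^ 2 ∈ Subgroup.center E := by
  have : Subgroup.closure {t, y} ≤ Subgroup.centralizer {y ^ 2} := by
    rw [Subgroup.closure_le]
    rintro g (rfl | rfl)
    · exact Subgroup.mem_centralizer_singleton_iff.2 (h.commute_sq_left hn hgcd).eq.symm
    · exact Subgroup.mem_centralizer_singleton_iff.2 ((Commute.refl g).pow_right 2).eq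
  rw [h.closure_eq_top] at this
  exact Subgroup.mem_center_iff.2 fun g =>
    Subgroup.mem_centralizer_singleton_iff.1 (this (Subgroup.mem_top g))

/-- Normal form of the elements when the secondary divisor is trivial. -/
theorem exists_eq_zpow_mul (h : IsQuarticExtension n 0 0 p p t y) (hn : 0 < n)
    (hgcd : Int.gcd n p = 1) (g : E) :
    ∃ i j : ℤ, ∃ k < 2, g = (y ^ 2) ^ i * t ^ j * y ^ k := by
  obtain ⟨e, he⟩ := exists_pow_eq_of_gcd_eq_one h.pow_eq_one hn hgcd
  have hc := h.commute_sq_left hn hgcd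
  have hcy : Commute (y ^ 2) y := (Commute.refl y).pow_left 2
  -- With `t = (t^p)^e`, this is `conj_zpow_eq` at exponent `e * j`; it moves `y` to the right past
  -- powers of `t`.
  have hconj : ∀ j : ℤ, y * t ^ j = (y ^ 2) ^ (-(2 * (e * j))) * t ^ (-j) * y := by
    intro j
    have := h.conj_zpow_eq (e * j)
    rw [neg_mul_eq_mul_neg (e : ℤ) j, zpow_mul (t ^ p) e j, zpow_mul (t ^ p) e (-j), zpow_natCast,
      he, mul_inv_eq_iff_eq_mul] at this
    exact this
  have ht : ∀ (a : ℤ) (u : E), (∃ i j : ℤ, ∃ k < 2, u = (y ^ 2) ^ i * t ^ j * y ^ k) →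
      ∃ i j : ℤ, ∃ k < 2, t ^ a * u = (y ^ 2) ^ i * t ^ j * y ^ k := by
    rintro a _ ⟨i, j, k, hk, rfl⟩
    refine ⟨i, a + j, k, hk, ?_⟩
    rw [← mul_assoc, ← mul_assoc, ← (hc.zpow_zpow i a).eq, zpow_add]
    simp only [mul_assoc]
  have hy : ∀ (a : ℤ) (u : E), (∃ i j : ℤ, ∃ k < 2, u = (y ^ 2) ^ i * t ^ j * y ^ k) →
      ∃ i j : ℤ, ∃ k < 2, (y ^ 2) ^ a * y * u = (y ^ 2) ^ i * t ^ j * y ^ k := by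
    rintro a _ ⟨i, j, k, hk, rfl⟩
    have h1 : (y ^ 2) ^ a * y * ((y ^ 2) ^ i * t ^ j * y ^ k) =
        (y ^ 2) ^ (a + i - 2 * (e * j)) * t ^ (-j) * y ^ (k + 1) := by
      rw [← mul_assoc, ← mul_assoc, mul_assoc _ y, ← (hcy.zpow_left i).eq, ← mul_assoc,
        ← zpow_add, mul_assoc _ y, hconj, sub_eq_add_neg, zpow_add _ (a + i), pow_succ' y k]
      simp only [mul_assoc]
    obtain rfl | rfl : k = 0 ∨ k = 1 := by omega
    · exact ⟨_, _, 1, by norm_num, h1⟩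
    · refine ⟨a + i - 2 * (e * j) + 1, -j, 0, by norm_num, ?_⟩
      rw [h1, pow_zero, mul_one, zpow_add_one, mul_assoc, mul_assoc, (hc.zpow_right (-j)).eq]
  have hg : g ∈ Subgroup.closure {t, y} := h.closure_eq_top ▸ Subgroup.mem_top g
  induction hg using Subgroup.closure_induction_left with
  | one => exact ⟨0, 0, 0, by norm_num, by simp⟩
  | mul_left u hu v _ ih =>
    rcases hu with rfl | rfl
    · simpa using ht 1 v ih
    · simpa using hy 0 v ih
  | inv_mul_cancel u hu v _ ih =>
    rcases hu with rfl | rfl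
    · simpa using ht (-1) v ih
    · have h1 : (u ^ 2) ^ (-1 : ℤ) * u = u⁻¹ := by group
      exact h1 ▸ hy (-1) v ih

theorem finite_of_gcd_eq_one' (h : IsQuarticExtension n 0 0 p p t y) (hn : 0 < n)
    (hgcd : Int.gcd n p = 1) : Finite E := by
  have : Finite (Subgroup.zpowers (y ^ 2)) := finite_zpowers.2 (h.isOfFinOrder_sq hn)
  have : Finite (Subgroup.zpowers t) := finite_zpowers.2 (h.isOfFinOrder_left hn)
  refine Finite.of_surjective (fun u : Subgroup.zpowers (y ^ 2) × Subgroup.zpowers t × Fin 2 =>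
    (u.1 : E) * u.2.1 * y ^ (u.2.2 : ℕ)) fun g => ?_
  obtain ⟨i, j, k, hk, rfl⟩ := h.exists_eq_zpow_mul hn hgcd g
  exact ⟨(⟨_, i, rfl⟩, ⟨_, j, rfl⟩, ⟨k, hk⟩), rfl⟩

theorem isMetacyclic_or_isCyclicCentralExtension (h : IsQuarticExtension n 0 0 p p t y)
    (hn : 0 < n) (hgcd : Int.gcd n p = 1) (ht : π t = Multiplicative.ofAdd 1) {a : ℤ}
    (hy : π y = Multiplicative.ofAdd (a : ZMod n)) {G : Type*} [Group G] {ι : G →* E}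
    (hι : Function.Injective ι) (hrange : ι.range = π.ker) :
    IsMetacyclic G ∨ IsCyclicCentralExtensionOfDihedral G := by
  -- Applying `π` to the relation. If 4 divided `n`, then `p` and `n` would both be even; so `n` is
  -- `m` or `2m` with `m` odd.
  have hdvd : (n : ℤ) ∣ 4 * a + 2 * p := by
    have := congrArg π h.rel
    simp only [zpow_zero, mul_one, map_mul, map_one, map_zpow_eq ht, hy, ← ofAdd_add,
      ofAdd_eq_one] at this
    rw [← ZMod.intCast_zmod_eq_zero_iff_dvd]
    push_cast
    rw [← this]
    ring
  have h4 : ¬ 4 ∣ n := by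
    intro h4
    have h5 : (4 : ℤ) ∣ n := by exact_mod_cast h4
    have h6 : (2 : ℤ) ∣ (Int.gcd n p : ℕ) := Int.dvd_coe_gcd (by omega) (by
      have := h5.trans hdvd
      omega)
    rw [hgcd] at h6
    omega
  obtain ⟨m, hm, hmn⟩ : ∃ m : ℕ, m % 2 = 1 ∧ (n = m ∨ n = 2 * m) := by
    rcases Nat.even_or_odd' n with ⟨m, rfl | rfl⟩
    · exact ⟨m, by omega, Or.inr rfl⟩
    · exact ⟨2 * m + 1, by omega, Or.inl rfl⟩
  have hn0 : (n : ZMod m) = 0 := by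
    rw [ZMod.natCast_eq_zero_iff]
    rcases hmn with rfl | rfl
    exacts [dvd_rfl, Dvd.intro_left _ rfl]
  obtain ⟨f, hft, hfy⟩ := h.exists_hom (DihedralGroup.r 1 : DihedralGroup m)
    (DihedralGroup.sr 0) (by simp [hn0]) (by simp)
  have hft' : ∀ i : ℤ, f (t ^ i) = DihedralGroup.r (i : ZMod m) := by
    intro i
    rw [map_zpow, hft, DihedralGroup.r_one_zpow]
  have hfc : f (y ^ 2) = 1 := by
    rw [map_pow, hfy, pow_two, DihedralGroup.sr_mul_self]
  -- In the normal form, trivial dihedral image excludes the factor `y` and gives `m ∣ j`; if `n =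
  -- 2m`, triviality under `π` makes `j` even as well. Hence `n ∣ j` and only a power of `y^2`
  -- remains.
  have hker : ∀ g, f g = 1 → π g = 1 → g ∈ Subgroup.zpowers (y ^ 2) := by
    intro g hfg hπg
    obtain ⟨i, j, k, hk, rfl⟩ := h.exists_eq_zpow_mul hn hgcd g
    rw [map_mul, map_mul, map_zpow, hfc, one_zpow, one_mul, hft', map_pow, hfy] at hfg
    obtain rfl | rfl : k = 0 ∨ k = 1 := by omega
    · have h1 : (m : ℤ) ∣ j := by
        rw [← ZMod.intCast_zmod_eq_zero_iff_dvd]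
        rw [pow_zero, mul_one, ← DihedralGroup.r_zero] at hfg
        exact DihedralGroup.r.inj hfg
      have h2 : (n : ℤ) ∣ 2 * a * i + j := by
        rw [pow_zero, mul_one, map_mul, map_zpow, map_pow, hy, map_zpow_eq ht, ← ofAdd_nsmul,
          ← ofAdd_zsmul, ← ofAdd_add, ofAdd_eq_one] at hπg
        rw [← ZMod.intCast_zmod_eq_zero_iff_dvd]
        push_cast
        rw [← hπg]
        simp only [zsmul_eq_mul, nsmul_eq_mul]
        push_cast
        ring
      have h3 : (n : ℤ) ∣ j := by
        rcases hmn with rfl | rfl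
        · exact h1
        · push_cast at h2 ⊢
          refine IsCoprime.mul_dvd ?_ ?_ h1
          · rw [Int.isCoprime_iff_gcd_eq_one]
            have : Nat.Coprime 2 m := (Nat.coprime_two_left).2 (Nat.odd_iff.2 hm)
            exact_mod_cast this
          · have h5 : (2 : ℤ) ∣ 2 * a * i + j := (Dvd.intro _ rfl).trans h2
            rw [mul_assoc] at h5
            exact (Int.dvd_add_right (Dvd.intro _ rfl)).1 h5
      refine ⟨i, ?_⟩
      obtain ⟨c, rfl⟩ := h3
      simp [zpow_mul t, h.pow_eq_one]
    · rw [pow_one, DihedralGroup.r_mul_sr, DihedralGroup.one_def] at hfg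
      cases hfg
  have hπι : ∀ g, π (ι g) = 1 := fun g => by
    have : ι g ∈ π.ker := hrange ▸ ⟨g, rfl⟩
    exact this
  have hker' : ∀ g : (f.comp ι).ker, ι g ∈ Subgroup.zpowers (y ^ 2) := fun g =>
    hker _ g.2 (hπι g)
  have hcyc : IsCyclic (f.comp ι).ker := by
    refine isCyclic_of_injective ((ι.comp (f.comp ι).ker.subtype).codRestrict
      (Subgroup.zpowers (y ^ 2)) hker') fun u v huv => ?_
    exact Subtype.ext (hι (congrArg Subtype.val huv))
  rcases Nat.lt_or_ge m 3 with hm3 | hm3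
  -- As `m` is odd, the only small case is `m = 1`, where the dihedral group is cyclic of order 2
  -- and `G` is metacyclic.
  · obtain rfl : m = 1 := by omega
    have : IsCyclic (DihedralGroup 1) := DihedralGroup.isCyclic_iff.2 rfl
    exact Or.inl ⟨(f.comp ι).ker, inferInstance, hcyc,
      isCyclic_of_injective (QuotientGroup.kerLift (f.comp ι)) (QuotientGroup.kerLift_injective _)⟩
  · refine Or.inr ⟨m, f.comp ι, hm3, ?_, ?_, hcyc⟩
    · have hmem : ∀ u, π u = 1 → f u ∈ (f.comp ι).range := by
        intro u hu
        have : u ∈ ι.range := hrange ▸ hu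
        obtain ⟨g, rfl⟩ := this
        exact ⟨g, rfl⟩
      have h1 : DihedralGroup.sr (-a : ZMod m) ∈ (f.comp ι).range := by
        have := hmem (y * t ^ (-a)) (by
          rw [map_mul, map_zpow_eq ht, hy, ← ofAdd_add]
          simp)
        rw [map_mul, hft', hfy] at this
        simpa using this
      -- The commutator of `y` and `t` lies in `G` and maps to the rotation by `-2`, which generates
      -- all rotations because `m` is odd.
      have h2 : DihedralGroup.r (-2 : ZMod m) ∈ (f.comp ι).range := by
        have := hmem (y * t ^ (1 : ℤ) * y⁻¹ * (t ^ (1 : ℤ))⁻¹) (by simp)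
        rw [map_mul, map_mul, map_mul, map_inv, map_inv, hft', hfy] at this
        simp only [DihedralGroup.inv_sr, DihedralGroup.inv_r, DihedralGroup.sr_mul_r,
          DihedralGroup.sr_mul_sr, DihedralGroup.r_mul_r] at this
        convert this using 2
        push_cast
        ring
      have h3 : ∀ i : ℤ, DihedralGroup.r (i : ZMod m) ∈ (f.comp ι).range := by
        intro i
        obtain ⟨b, hb⟩ : ∃ b : ℤ, (m : ℤ) = 2 * b + 1 := ⟨m / 2, by omega⟩
        have := Subgroup.zpow_mem _ h2 (i * b)
        rw [DihedralGroup.r_zpow] at this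
        convert this using 2
        have h5 := congrArg (Int.cast : ℤ → ZMod m) hb
        push_cast at h5 ⊢
        rw [ZMod.natCast_self] at h5
        linear_combination -(i : ZMod m) * h5
      rw [← MonoidHom.range_eq_top, eq_top_iff]
      rintro (i | i) -
      · obtain ⟨i, rfl⟩ := ZMod.intCast_surjective i
        exact h3 i
      · obtain ⟨i, rfl⟩ := ZMod.intCast_surjective i
        have := mul_mem h1 (h3 (a + i))
        rw [DihedralGroup.sr_mul_r] at this
        simpa using this
    · intro g hg
      obtain ⟨i, hi⟩ := hker' ⟨g, hg⟩
      have hz : ι g ∈ Subgroup.center E := by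
        have := Subgroup.zpow_mem _ (h.sq_mem_center hn hgcd) i
        exact hi ▸ this
      rw [Subgroup.mem_center_iff] at hz ⊢
      exact fun v => hι (by rw [map_mul, map_mul, hz])

end Dihedral

end IsQuarticExtension
end CyclicPresentation

/-! ### Free `ℤ[G]`-modules restricted to a finite cyclic subgroup. -/

section CyclicActions

open Finset MonoidAlgebra

variable {G : Type*} [Group G]

/-- A decomposition of a module over `ℤ[G]` as a direct sum of translates, under the powers of `g`,
of the image of an additive endomorphism `e`. -/
def IsTranslateProjection (g : G) {M : Type*} [AddCommGroup M] [Module (MonoidAlgebra ℤ G) M]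
    (e : M →+ M) : Prop :=
  ∀ m, ∑ i ∈ range (orderOf g), of ℤ G (g ^ i)⁻¹ • e (of ℤ G (g ^ i) • m) = m

theorem of_smul_of_smul {M : Type*} [AddCommGroup M] [Module (MonoidAlgebra ℤ G) M] (a b : G)
    (m : M) : of ℤ G a • of ℤ G b • m = of ℤ G (a * b) • m := by
  rw [smul_smul, map_mul]

/-- Choosing representatives of the right cosets of `⟨g⟩`, the index records the power of `g`
separating an element from its representative. -/
theorem exists_coset_index (g : G) :
    ∃ κ : G → ZMod (orderOf g), ∀ (i : ℤ) (x : G), κ (g ^ i * x) = κ x + i := by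
  have hex : ∀ x : G, ∃ i : ℤ,
      x = g ^ i * (Quotient.mk (QuotientGroup.rightRel (Subgroup.zpowers g)) x).out := by
    intro x
    have h := Quotient.mk_out (s := QuotientGroup.rightRel (Subgroup.zpowers g)) x
    rw [QuotientGroup.rightRel_apply] at h
    obtain ⟨i, hi⟩ := h
    refine ⟨i, ?_⟩
    rw [show g ^ i = _ from hi]
    simp
  choose f hf using hex
  refine ⟨fun x => f x, fun i x => ?_⟩
  have h1 : (Quotient.mk (QuotientGroup.rightRel (Subgroup.zpowers g)) (g ^ i * x)) =
      Quotient.mk _ x := by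
    refine Quotient.sound ?_
    change QuotientGroup.rightRel (Subgroup.zpowers g) _ _
    rw [QuotientGroup.rightRel_apply]
    exact ⟨-i, by simp⟩
  have h2 := hf (g ^ i * x)
  rw [h1] at h2
  nth_rw 1 [hf x] at h2
  rw [← mul_assoc, mul_left_inj, ← zpow_add, zpow_eq_zpow_iff_modEq,
    ← ZMod.intCast_eq_intCast_iff] at h2
  change ((f (g ^ i * x) : ℤ) : ZMod (orderOf g)) = (f x : ZMod (orderOf g)) + i
  rw [← h2]
  push_cast
  ring

theorem exists_isTranslateProjection {g : G} (hg : IsOfFinOrder g) :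
    ∃ e : MonoidAlgebra ℤ G →+ MonoidAlgebra ℤ G, IsTranslateProjection g e := by
  classical
  obtain ⟨κ, hκ⟩ := exists_coset_index g
  have : NeZero (orderOf g) := ⟨hg.orderOf_pos.ne'⟩
  -- Restriction of the support to the coset representatives; these form a basis over `ℤ[⟨g⟩]`.
  let e : MonoidAlgebra ℤ G →+ MonoidAlgebra ℤ G :=
    { toFun := fun a => ofCoeff (a.coeff.filter fun x => κ x = 0)
      map_zero' := by rw [coeff_zero, Finsupp.filter_zero, ofCoeff_zero]
      map_add' := fun a b => by rw [coeff_add, Finsupp.filter_add, ofCoeff_add] }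
  have he : ∀ x r, e (single x r) = if κ x = 0 then single x r else 0 := by
    intro x r
    change ofCoeff ((single x r).coeff.filter fun x => κ x = 0) = _
    split_ifs with h
    · rw [coeff_single, Finsupp.filter_single_of_pos (fun x => κ x = 0) h, ofCoeff_single]
    · rw [coeff_single, Finsupp.filter_single_of_neg (fun x => κ x = 0) h, ofCoeff_zero]
  refine ⟨e, fun m => ?_⟩
  induction m using MonoidAlgebra.induction_linear with
  | zero => simp
  | add x y hx hy => simp only [smul_add, map_add, Finset.sum_add_distrib, hx, hy]
  | single x r =>
    have hκ' : ∀ i : ℕ, κ (g ^ i * x) = κ x + i := fun i => by simpa using hκ i x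
    rw [Finset.sum_eq_single_of_mem (-κ x).val (Finset.mem_range.2 (ZMod.val_lt _))]
    · rw [smul_eq_mul, smul_eq_mul, of_apply, of_apply, single_mul_single, he, hκ',
        if_pos (by simp),
        single_mul_single]
      simp
    · intro i hi hne
      rw [smul_eq_mul (of ℤ G (g ^ i)), of_apply, of_apply, single_mul_single, he, hκ', if_neg,
        smul_zero]
      intro h
      refine hne ?_
      rw [neg_eq_of_add_eq_zero_right h, ZMod.val_natCast_of_lt (Finset.mem_range.1 hi)]

theorem IsTranslateProjection.mapRange {g : G} {e : MonoidAlgebra ℤ G →+ MonoidAlgebra ℤ G}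
    (he : IsTranslateProjection g e) (Y : Type*) :
    IsTranslateProjection g (Finsupp.mapRange.addMonoidHom (ι := Y) e) := by
  intro m
  ext1 y
  rw [Finsupp.finsetSum_apply]
  simpa using he (m y)

variable {g : G} {M : Type*} [AddCommGroup M] [Module (MonoidAlgebra ℤ G) M] {e : M →+ M}

/-- Vanishing of Tate cohomology in degree 0: for fixed `m` the decomposition has constant terms `e
m`, so `m` is a norm. The shift by `orderOf g - 1` in the witness turns inverse powers into powers.
-/
theorem IsTranslateProjection.exists_eq_sum (he : IsTranslateProjection g e) {m : M}
    (hm : of ℤ G g • m = m) : ∃ b, m = ∑ i ∈ range (orderOf g), of ℤ G (g ^ i) • b := by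
  have hpow : ∀ i : ℕ, of ℤ G (g ^ i) • m = m := by
    intro i
    induction i with
    | zero => rw [pow_zero, map_one, one_smul]
    | succ i ih => rw [pow_succ, ← of_smul_of_smul, hm, ih]
  refine ⟨of ℤ G (g ^ (orderOf g - 1))⁻¹ • e m, ?_⟩
  rw [← Finset.sum_range_reflect]
  nth_rw 1 [← he m]
  refine Finset.sum_congr rfl fun i hi => ?_
  rw [Finset.mem_range] at hi
  rw [hpow, of_smul_of_smul, pow_sub g (by omega : i ≤ orderOf g - 1)]
  congr 2
  group

/-- Vanishing of Tate cohomology in degree -1: the elements `e (g^i m)` add up to `e` of the norm of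
`m`, which is zero, so `m` is a sum of terms `(g^(-i) - 1) e (g^i m)`, each a multiple of `g - 1`.
-/
theorem IsTranslateProjection.exists_eq_sub (he : IsTranslateProjection g e) {m : M}
    (hm : ∑ i ∈ range (orderOf g), of ℤ G (g ^ i) • m = 0) :
    ∃ d, m = of ℤ G g • d - d := by
  let δ : M →+ M := DistribSMul.toAddMonoidHom M (of ℤ G g) - AddMonoidHom.id M
  have hδ : ∀ z, δ z = of ℤ G g • z - z := fun z => rfl
  have hmem : ∀ (i : ℕ) (z : M), of ℤ G (g ^ i)⁻¹ • z - z ∈ δ.range := by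
    intro i z
    induction i with
    | zero =>
      rw [pow_zero, inv_one, map_one, one_smul, sub_self]
      exact zero_mem _
    | succ i ih =>
      have h : of ℤ G (g ^ (i + 1))⁻¹ • z - z = δ (-(of ℤ G (g ^ (i + 1))⁻¹ • z)) +
          (of ℤ G (g ^ i)⁻¹ • z - z) := by
        rw [hδ, smul_neg, of_smul_of_smul]
        have : g * (g ^ (i + 1))⁻¹ = (g ^ i)⁻¹ := by rw [pow_succ]; group
        rw [this]
        abel
      rw [h]
      exact add_mem ⟨_, rfl⟩ ih
  have hsum : m = ∑ i ∈ range (orderOf g),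
      (of ℤ G (g ^ i)⁻¹ • e (of ℤ G (g ^ i) • m) - e (of ℤ G (g ^ i) • m)) := by
    rw [Finset.sum_sub_distrib, he m, ← map_sum, hm, map_zero, sub_zero]
  obtain ⟨d, hd⟩ : m ∈ δ.range := by
    rw [hsum]
    exact sum_mem fun i _ => hmem i _
  exact ⟨d, hd.symm⟩

end CyclicActions

/-! ### Crossed homomorphisms on free groups. -/

namespace GroupPresentation

open MonoidAlgebra

section Fox

variable {Y : Type*} {G : Type*} [Group G] {M : Type*} [AddCommGroup M]
  [Module (MonoidAlgebra ℤ G) M]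

/-- The affine automorphism `m ↦ g m + c`. -/
noncomputable def affinePerm (g : G) (c : M) : Equiv.Perm M where
  toFun m := of ℤ G g • m + c
  invFun m := of ℤ G g⁻¹ • (m - c)
  left_inv m := by simp [of_smul_of_smul, - of_apply]
  right_inv m := by simp [of_smul_of_smul, - of_apply]

/-- The crossed homomorphism, over `ρ`, extending a map on the basis of a free group. -/
noncomputable def crossedHom (ρ : FreeGroup Y →* G) (d : Y → M) (u : FreeGroup Y) : M :=
  FreeGroup.lift (fun y => affinePerm (ρ (FreeGroup.of y)) (d y)) u 0

variable (ρ : FreeGroup Y →* G) (d : Y → M)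

/-- A crossed homomorphism is the translation part of a homomorphism to affine permutations with
linear part `ρ`; its product rule is composition of affine maps. -/
theorem lift_affinePerm (u : FreeGroup Y) (m : M) :
    FreeGroup.lift (fun y => affinePerm (ρ (FreeGroup.of y)) (d y)) u m =
      of ℤ G (ρ u) • m + crossedHom ρ d u := by
  induction u using FreeGroup.induction_on generalizing m with
  | C1 => simp [crossedHom, -of_apply]
  | of y => simp [crossedHom, affinePerm, -of_apply]
  | inv_of y _ =>
    simp only [crossedHom, map_inv, FreeGroup.lift_apply_of]
    change of ℤ G _ • (_ - _) = of ℤ G _ • _ + of ℤ G _ • ((0 : M) - _)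
    rw [smul_sub, smul_sub, smul_zero]
    abel
  | mul u v hu hv =>
    have h : ∀ m : M, FreeGroup.lift (fun y => affinePerm (ρ (FreeGroup.of y)) (d y)) (u * v) m =
        of ℤ G (ρ (u * v)) • m + (of ℤ G (ρ u) • crossedHom ρ d v + crossedHom ρ d u) := by
      intro m
      rw [map_mul, Equiv.Perm.mul_apply, hv, hu, smul_add, of_smul_of_smul, ← map_mul ρ, add_assoc]
    have h0 : crossedHom ρ d (u * v) = _ := h 0
    rw [h, h0, smul_zero, zero_add]

theorem crossedHom_mul (u v : FreeGroup Y) :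
    crossedHom ρ d (u * v) = crossedHom ρ d u + of ℤ G (ρ u) • crossedHom ρ d v := by
  rw [crossedHom, map_mul, Equiv.Perm.mul_apply, lift_affinePerm ρ d u]
  exact add_comm _ _

theorem crossedHom_of (y : Y) : crossedHom ρ d (FreeGroup.of y) = d y := by
  simp [crossedHom, affinePerm]

theorem crossedHom_one : crossedHom ρ d 1 = 0 := by
  simp [crossedHom]

theorem crossedHom_inv (u : FreeGroup Y) :
    crossedHom ρ d u⁻¹ = -(of ℤ G (ρ u)⁻¹ • crossedHom ρ d u) := by
  have h := crossedHom_mul ρ d u⁻¹ u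
  rw [inv_mul_cancel, crossedHom_one, map_inv] at h
  exact eq_neg_of_add_eq_zero_left h.symm

theorem crossedHom_pow (u : FreeGroup Y) (k : ℕ) :
    crossedHom ρ d (u ^ k) = ∑ i ∈ Finset.range k, of ℤ G (ρ u ^ i) • crossedHom ρ d u := by
  induction k with
  | zero => simp [crossedHom_one]
  | succ k ih => rw [pow_succ, crossedHom_mul, ih, Finset.sum_range_succ, map_pow]

end Fox

end GroupPresentation

/-! ### Fox calculus, identities, and torsion as an obstruction to asphericity. -/

namespace GroupPresentation

open MonoidAlgebra

variable {X : Type*} (R : Set (FreeGroup X))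

/-- The integral group ring of the presented group. -/
abbrev GroupRing : Type _ := MonoidAlgebra ℤ (PresentedGroup R)

/-- The homomorphism from the free group on `F × R` to the free module on `R` that sends `(u, r)` to
`u e_r`. -/
noncomputable def hurewicz (y : RelFree R) : R →₀ GroupRing R :=
  crossedHom (1 : RelFree R →* PresentedGroup R)
    (fun p => Finsupp.single p.2 (of ℤ _ (PresentedGroup.mk R p.1))) y

theorem hurewicz_of (u : FreeGroup X) (r : R) :
    hurewicz R (FreeGroup.of (u, r)) = Finsupp.single r (of ℤ _ (PresentedGroup.mk R u)) :=
  crossedHom_of _ _ _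

theorem hurewicz_one : hurewicz R 1 = 0 := crossedHom_one _ _

theorem hurewicz_mul (y z : RelFree R) :
    hurewicz R (y * z) = hurewicz R y + hurewicz R z := by
  rw [hurewicz, crossedHom_mul, MonoidHom.one_apply, map_one, one_smul]
  rfl

/-- `hurewicz` as a homomorphism to an additive group. -/
noncomputable def hurewiczHom : RelFree R →* Multiplicative (R →₀ GroupRing R) where
  toFun y := Multiplicative.ofAdd (hurewicz R y)
  map_one' := by rw [hurewicz_one]; rfl
  map_mul' y z := by rw [hurewicz_mul]; rfl

theorem hurewicz_inv (y : RelFree R) : hurewicz R y⁻¹ = -hurewicz R y :=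
  Multiplicative.ofAdd.injective (map_inv (hurewiczHom R) y)

theorem hurewicz_zpow (y : RelFree R) (k : ℤ) : hurewicz R (y ^ k) = k • hurewicz R y :=
  Multiplicative.ofAdd.injective (map_zpow (hurewiczHom R) y k)

theorem hurewicz_act (v : FreeGroup X) (y : RelFree R) :
    hurewicz R (act R v y) = of ℤ _ (PresentedGroup.mk R v) • hurewicz R y := by
  induction y using FreeGroup.induction_on with
  | C1 => rw [map_one, hurewicz_one, smul_zero]
  | of p =>
    obtain ⟨u, r⟩ := p
    rw [act_of, hurewicz_of, hurewicz_of, map_mul, map_mul, Finsupp.smul_single, smul_eq_mul]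
  | inv_of p ih => rw [map_inv, hurewicz_inv, hurewicz_inv, smul_neg, ih]
  | mul y z hy hz => rw [map_mul, hurewicz_mul, hurewicz_mul, smul_add, hy, hz]

theorem mk_relator (r : R) : PresentedGroup.mk R (r : FreeGroup X) = 1 :=
  PresentedGroup.one_of_mem r.2

/-- Relators are trivial in the presented group, so `v` and `u r^ε u⁻¹ v` give the same coefficient,
and the four terms cancel in an abelian group. -/
theorem hurewicz_eq_zero_of_mem_peiffer {y : RelFree R} (hy : y ∈ peiffer R) :
    hurewicz R y = 0 := by
  have h : peiffer R ≤ (hurewiczHom R).ker := by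
    refine Subgroup.normalClosure_le_normal ?_
    rintro _ ⟨u, v, r, s, ε, δ, rfl⟩
    change hurewicz R _ = 0
    have hmk : PresentedGroup.mk R (u * (r : FreeGroup X) ^ (ε : ℤ) * u⁻¹ * v) =
        PresentedGroup.mk R v := by
      simp [mk_relator]
    simp only [hurewicz_mul, hurewicz_zpow, hurewicz_of, hmk, neg_smul]
    abel
  exact h hy

/-- The total Fox derivative. -/
noncomputable def fox (u : FreeGroup X) : X →₀ GroupRing R :=
  crossedHom (PresentedGroup.mk R) (fun x => Finsupp.single x 1) u

/-- The second boundary map of the cellular chain complex of the universal cover. -/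
noncomputable def boundaryTwo : (R →₀ GroupRing R) →ₗ[GroupRing R] (X →₀ GroupRing R) :=
  Finsupp.linearCombination _ fun r => fox R r

/-- The first boundary map of the cellular chain complex of the universal cover. -/
noncomputable def boundaryOne : (X →₀ GroupRing R) →ₗ[GroupRing R] GroupRing R :=
  Finsupp.linearCombination _ fun x => of ℤ _ (PresentedGroup.mk R (FreeGroup.of x)) - 1

/-- The fundamental formula of Fox calculus. -/
theorem boundaryOne_fox (u : FreeGroup X) :
    boundaryOne R (fox R u) = of ℤ _ (PresentedGroup.mk R u) - 1 := by
  induction u using FreeGroup.induction_on with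
  | C1 => rw [fox, crossedHom_one, map_zero, map_one, map_one, sub_self]
  | of x => rw [fox, crossedHom_of, boundaryOne, Finsupp.linearCombination_single, one_smul]
  | inv_of x ih =>
    rw [fox, crossedHom_inv, map_neg, map_smul]
    change -(_ • boundaryOne R (fox R _)) = _
    rw [ih, smul_eq_mul, mul_sub, ← map_mul, inv_mul_cancel, map_inv (PresentedGroup.mk R), map_one,
      mul_one, neg_sub]
  | mul u v hu hv =>
    rw [fox, crossedHom_mul, map_add, map_smul]
    change boundaryOne R (fox R u) + _ • boundaryOne R (fox R v) = _
    rw [hu, hv, smul_eq_mul, mul_sub, ← map_mul, mul_one, ← map_mul]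
    abel

theorem boundaryOne_boundaryTwo (b : R →₀ GroupRing R) : boundaryOne R (boundaryTwo R b) = 0 := by
  have h : (boundaryOne R).comp (boundaryTwo R) = 0 := by
    refine Finsupp.lhom_ext fun r a => ?_
    rw [LinearMap.comp_apply, boundaryTwo, Finsupp.linearCombination_single, map_smul,
      boundaryOne_fox, mk_relator, map_one, sub_self, smul_zero, LinearMap.zero_apply]
  exact LinearMap.congr_fun h b

theorem mk_boundary (y : RelFree R) : PresentedGroup.mk R (boundary R y) = 1 := by
  have h : (PresentedGroup.mk R).comp (boundary R) = 1 := by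
    ext p
    obtain ⟨u, r⟩ := p
    simp only [MonoidHom.comp_apply, boundary_of, map_mul, mk_relator, map_inv, MonoidHom.one_apply]
    group
  exact DFunLike.congr_fun h y

/-- The Fox derivative of `u r u⁻¹` is `u` times that of `r`, since `r` is trivial in the group and
the two contributions of `u` cancel. -/
theorem boundaryTwo_hurewicz (y : RelFree R) :
    boundaryTwo R (hurewicz R y) = fox R (boundary R y) := by
  have hmul : ∀ u v, fox R (u * v) = fox R u + of ℤ _ (PresentedGroup.mk R u) • fox R v :=
    crossedHom_mul _ _
  have hinv : ∀ u, fox R u⁻¹ = -(of ℤ _ (PresentedGroup.mk R u)⁻¹ • fox R u) :=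
    crossedHom_inv _ _
  induction y using FreeGroup.induction_on with
  | C1 => rw [hurewicz_one, map_zero, map_one, fox, crossedHom_one]
  | of p =>
    obtain ⟨u, r⟩ := p
    rw [hurewicz_of, boundaryTwo, Finsupp.linearCombination_single, boundary_of, hmul, hmul, hinv,
      map_mul, mk_relator, mul_one, smul_neg, of_smul_of_smul, mul_inv_cancel, map_one, one_smul]
    abel
  | inv_of p ih =>
    rw [hurewicz_inv, map_neg, ih, map_inv, hinv, mk_boundary, inv_one, map_one, one_smul]
  | mul y z hy hz =>
    rw [hurewicz_mul, map_add, hy, hz, map_mul, hmul, mk_boundary, map_one, one_smul]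

theorem range_boundary : (boundary R).range = Subgroup.normalClosure R := by
  refine le_antisymm ?_ ?_
  · rintro _ ⟨y, rfl⟩
    exact (QuotientGroup.eq_one_iff _).1 (mk_boundary R y)
  · have : (boundary R).range.Normal := ⟨by
      rintro _ ⟨y, rfl⟩ v
      exact ⟨act R v y, boundary_act R v y⟩⟩
    refine Subgroup.normalClosure_le_normal fun r hr => ⟨FreeGroup.of (1, ⟨r, hr⟩), ?_⟩
    rw [boundary_of]
    simp

/-- The augmentation of the integral group ring. -/
noncomputable def augmentation : GroupRing R →ₐ[ℤ] ℤ :=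
  MonoidAlgebra.lift ℤ ℤ (PresentedGroup R) 1

theorem augmentation_of (g : PresentedGroup R) : augmentation R (of ℤ _ g) = 1 := by
  simp [augmentation]

theorem augmentation_boundaryOne (d : X →₀ GroupRing R) :
    augmentation R (boundaryOne R d) = 0 := by
  induction d using Finsupp.induction_linear with
  | zero => simp
  | add d d' hd hd' => rw [map_add, map_add, hd, hd', add_zero]
  | single x a =>
    rw [boundaryOne, Finsupp.linearCombination_single, smul_eq_mul, map_mul, map_sub,
      augmentation_of, map_one, sub_self, mul_zero]

/-- A presentation of a group with torsion has an identity with nontrivial image in the second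
chain module. -/
theorem exists_hurewicz_ne_zero {g : PresentedGroup R} (hg1 : g ≠ 1) (hg : IsOfFinOrder g) :
    ∃ y ∈ identities R, hurewicz R y ≠ 0 := by
  by_contra! hall
  obtain ⟨u, rfl⟩ := PresentedGroup.mk_surjective R g
  obtain ⟨α, hα⟩ : u ^ orderOf (PresentedGroup.mk R u) ∈ (boundary R).range := by
    rw [range_boundary]
    refine (QuotientGroup.eq_one_iff _).1 ?_
    change PresentedGroup.mk R _ = 1
    rw [map_pow, pow_orderOf_eq_one]
  -- The boundary `u^m` of `α` is unchanged by conjugation with `u`. If this identity maps to zero,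
  -- the image of `α` is fixed by `u`, hence is a norm, of some `b`.
  have hid : α⁻¹ * act R u α ∈ identities R := by
    rw [MonoidHom.mem_ker, map_mul, map_inv, boundary_act, hα]
    group
  have h1 := hall _ hid
  rw [hurewicz_mul, hurewicz_inv, hurewicz_act, neg_add_eq_zero] at h1
  obtain ⟨e, he⟩ := exists_isTranslateProjection hg
  obtain ⟨b, hb⟩ := (he.mapRange R).exists_eq_sum h1.symm
  -- The Fox derivative of `u^m` is the norm of that of `u`, and also the boundary of the norm of
  -- `b`.
  have h2 : ∑ i ∈ Finset.range (orderOf (PresentedGroup.mk R u)),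
      of ℤ _ (PresentedGroup.mk R u ^ i) • (boundaryTwo R b - fox R u) = 0 := by
    have h3 := boundaryTwo_hurewicz R α
    rw [hα, hb, map_sum, fox, crossedHom_pow] at h3
    simp only [smul_sub, Finset.sum_sub_distrib, ← map_smul]
    exact sub_eq_zero.2 h3
  obtain ⟨d, hd⟩ := (he.mapRange X).exists_eq_sub h2
  have h3 := congrArg (boundaryOne R) hd
  rw [map_sub, map_sub, map_smul, boundaryOne_boundaryTwo, boundaryOne_fox] at h3
  -- Applying `boundaryOne` gives `1 - u = (u - 1) ∂d`, so `1 + ∂d` is fixed by `u` and is a norm;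
  -- its augmentation 1 is then divisible by the order of `u`.
  obtain ⟨c, hc⟩ := he.exists_eq_sum (m := 1 + boundaryOne R d) (by
    rw [smul_add, smul_eq_mul, mul_one]
    rw [sub_eq_iff_eq_add.1 h3.symm]
    abel)
  have h4 := congrArg (augmentation R) hc
  simp only [map_add, map_one, augmentation_boundaryOne, map_sum, smul_eq_mul, map_mul,
    augmentation_of, one_mul, add_zero, Finset.sum_const, Finset.card_range, nsmul_eq_mul] at h4
  have h5 : (orderOf (PresentedGroup.mk R u) : ℤ) ∣ 1 := ⟨_, h4⟩
  have h6 : orderOf (PresentedGroup.mk R u) = 1 := by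
    have := Int.natAbs_dvd_natAbs.2 h5
    simpa using this
  exact hg1 (orderOf_eq_one_iff.1 h6)

/-- The map induced by `hurewicz` on identities modulo Peiffer identities. -/
noncomputable def pi2Hurewicz : Additive (Pi2 R) →+ (R →₀ GroupRing R) :=
  MonoidHom.toAdditiveLeft (QuotientGroup.lift _ ((hurewiczHom R).comp (identities R).subtype)
    fun _ hy => hurewicz_eq_zero_of_mem_peiffer R hy)

theorem pi2Hurewicz_pi2Rep (g : PresentedGroup R) (x : Additive (Pi2 R)) :
    pi2Hurewicz R (pi2Rep R g x) = of ℤ _ g • pi2Hurewicz R x := by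
  obtain ⟨v, rfl⟩ := PresentedGroup.mk_surjective R g
  induction x using Additive.rec with | _ x => ?_
  induction x using QuotientGroup.induction_on with | _ y => ?_
  exact hurewicz_act R v y

theorem pi2Hurewicz_smul (a : GroupRing R) (x : (pi2Rep R).asModule) :
    pi2Hurewicz R ((pi2Rep R).asModuleEquiv (a • x)) =
      a • pi2Hurewicz R ((pi2Rep R).asModuleEquiv x) := by
  rw [Representation.asModuleEquiv_map_smul]
  induction a using MonoidAlgebra.induction_on with
  | of g => rw [Representation.asAlgebraHom_of, pi2Hurewicz_pi2Rep]
  | add a b ha hb => rw [map_add, LinearMap.add_apply, map_add, ha, hb, add_smul]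
  | smul k a ha => rw [map_smul, LinearMap.smul_apply, map_zsmul, ha, smul_assoc]

open Classical in
/-- A presentation of a group with torsion is not combinatorially aspherical when all identities of
length two are trivial. -/
theorem not_combinatoriallyAspherical {g : PresentedGroup R} (hg1 : g ≠ 1) (hg : IsOfFinOrder g)
    (hR : ∀ y ∈ identities R, y.norm = 2 → hurewicz R y = 0) : ¬ CombinatoriallyAspherical R := by
  intro h
  obtain ⟨y, hy, hy0⟩ := exists_hurewicz_ne_zero R hg1 hg
  have hall : ∀ x : (pi2Rep R).asModule, pi2Hurewicz R ((pi2Rep R).asModuleEquiv x) = 0 := by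
    intro x
    have hx : x ∈ Submodule.span (GroupRing R) {m : (pi2Rep R).asModule |
        ∃ y : identities R, (y : RelFree R).norm = 2 ∧ m = pi2Class R y} := h ▸ Submodule.mem_top
    induction hx using Submodule.span_induction with
    | mem x hx =>
      obtain ⟨z, hz, rfl⟩ := hx
      exact hR z z.2 hz
    | zero => rw [map_zero, map_zero]
    | add x z _ _ hx hz => rw [map_add, map_add, hx, hz, add_zero]
    | smul a x _ hx => rw [pi2Hurewicz_smul, hx, smul_zero]
  exact hy0 (hall (pi2Class R ⟨y, hy⟩))

end GroupPresentation

/-! ### Conjugacy of positive words in a free group. -/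

namespace FreeGroup

variable {X : Type*}

/-- The positive word with the given letters. -/
def positive (L : List X) : FreeGroup X := mk (L.map fun x => (x, true))

theorem positive_nil : positive ([] : List X) = 1 := rfl

theorem positive_append (L M : List X) : positive (L ++ M) = positive L * positive M := by
  rw [positive, List.map_append, ← mul_mk]
  rfl

theorem positive_singleton (x : X) : positive [x] = of x := rfl

theorem positive_cons (x : X) (L : List X) : positive (x :: L) = of x * positive L :=
  positive_append [x] L

theorem isReduced_positive (L : List X) : IsReduced (L.map fun x => (x, true)) := by
  rw [IsReduced, List.isChain_map]
  induction L with
  | nil => exact List.isChain_nil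
  | cons x L ih => exact List.isChain_cons.2 ⟨fun _ _ _ => rfl, ih⟩

/-- Conjugate positive words of the same length are cyclic permutations of each other, and the
conjugating elements are the obvious ones. -/
theorem exists_rotate_of_conj_positive {s : List X} (W : List (X × Bool)) (hW : IsReduced W) :
    ∀ r : List X, r ≠ [] → r.length = s.length →
      mk W * positive r * (mk W)⁻¹ = positive s →
      ∃ i < r.length, ∃ k : ℤ, s = r.rotate i ∧ mk W * positive (r.take i) = positive s ^ k := by
  classical
  induction W using List.reverseRecOn with
  | nil =>
    intro r hr hlen h
    refine ⟨0, List.length_pos_iff.2 hr, 0, ?_, ?_⟩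
    · rw [← one_eq_mk, one_mul, inv_one, mul_one] at h
      have h1 := congrArg toWord h
      rw [positive, positive, toWord_mk, toWord_mk,
          isReduced_iff_reduce_eq.1 (isReduced_positive r),
        isReduced_iff_reduce_eq.1 (isReduced_positive s)] at h1
      have h2 := congrArg (List.map Prod.fst) h1
      simpa [Function.comp_def] using h2.symm
    · simp [← one_eq_mk, positive_nil]
  | append_singleton W y ih =>
    obtain ⟨x, c⟩ := y
    intro r hr hlen h
    have hW' : IsReduced W := (List.isChain_append.1 hW).1
    have hmk : mk (W ++ [(x, c)]) = mk W * mk [(x, c)] := mul_mk.symm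
    -- Without cancellation the conjugate would be longer than `s`. So the last letter of the
    -- conjugator cancels the first or last letter of `r`, according to its sign; this rotates `r`
    -- by one place and shortens the conjugator.
    by_cases hred : IsReduced (W ++ [(x, c)] ++ r.map (fun x => (x, true)) ++
        invRev (W ++ [(x, c)]))
    · exfalso
      have h1 := congrArg toWord h
      rw [positive, positive, inv_mk, mul_mk, mul_mk, toWord_mk, toWord_mk,
        isReduced_iff_reduce_eq.1 hred, isReduced_iff_reduce_eq.1 (isReduced_positive s)] at h1
      have h2 := congrArg List.length h1
      simp only [List.length_append, List.length_map, List.length_singleton, invRev_length] at h2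
      omega
    · cases c with
      | false =>
        obtain ⟨z, r, rfl⟩ := List.exists_cons_of_ne_nil hr
        have hz : z = x := by
          by_contra hz
          refine hred (List.isChain_append.2 ⟨List.isChain_append.2
            ⟨hW, isReduced_positive _, ?_⟩, ?_, ?_⟩)
          · intro p hp q hq
            simp only [List.getLast?_append, List.getLast?_singleton, Option.some_or,
              Option.mem_def, Option.some.injEq] at hp
            simp only [List.map_cons, List.head?_cons, Option.mem_def, Option.some.injEq] at hq
            subst hp hq
            exact fun h => absurd h.symm hz
          · have := isReduced_toWord (x := (mk (W ++ [(x, false)]))⁻¹)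
            rwa [toWord_inv, toWord_mk, isReduced_iff_reduce_eq.1 hW] at this
          · intro p hp q hq
            have hp2 : p.2 = true := by
              rw [List.getLast?_append_of_ne_nil _ (by simp)] at hp
              obtain ⟨a, -, rfl⟩ := List.mem_map.1 (List.mem_of_mem_getLast? hp)
              rfl
            simp only [invRev, List.map_append, List.reverse_append, List.map_cons, List.map_nil,
              List.reverse_singleton, List.singleton_append, List.head?_cons, Option.mem_def,
              Option.some.injEq] at hq
            subst hq
            exact fun _ => hp2
        subst hz
        have hmk' : mk (W ++ [(z, false)]) = mk W * (of z)⁻¹ := hmk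
        obtain ⟨i, hi, k, hs, hk⟩ := ih hW' (r ++ [z]) (by simp) (by simpa using hlen) (by
          rw [← h, hmk', positive_append, positive_singleton, positive_cons]
          group)
        have hi' : i ≤ r.length := by simpa [Nat.lt_succ_iff] using hi
        rw [List.take_append_of_le_length hi'] at hk
        have hk' : mk (W ++ [(z, false)]) * positive (z :: r.take i) = positive s ^ k := by
          rw [hmk', positive_cons, ← hk]
          group
        rcases hi'.lt_or_eq with hi' | rfl
        · refine ⟨i + 1, by simpa using hi', k, ?_, ?_⟩
          · rw [List.rotate_cons_succ, hs]
          · rw [List.take_succ_cons, hk']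
        -- A full rotation is recorded as rotation by 0, at the cost of one factor `s`.
        · rw [List.rotate_append_length_eq] at hs
          refine ⟨0, by simp, k - 1, by simpa using hs, ?_⟩
          rw [List.take_length] at hk'
          rw [List.take_zero, positive_nil, mul_one, zpow_sub_one, eq_mul_inv_iff_mul_eq, hs]
          rwa [hs] at hk'
      | true =>
        obtain ⟨r, z, rfl⟩ := (List.eq_nil_or_concat' r).resolve_left hr
        have hz : z = x := by
          by_contra hz
          refine hred (List.isChain_append.2 ⟨List.isChain_append.2
            ⟨hW, isReduced_positive _, ?_⟩, ?_, ?_⟩)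
          · intro p hp q hq
            simp only [List.getLast?_append, List.getLast?_singleton, Option.some_or,
              Option.mem_def, Option.some.injEq] at hp
            obtain ⟨a, -, rfl⟩ := List.mem_map.1 (List.mem_of_mem_head? hq)
            subst hp
            exact fun _ => rfl
          · have := isReduced_toWord (x := (mk (W ++ [(x, true)]))⁻¹)
            rwa [toWord_inv, toWord_mk, isReduced_iff_reduce_eq.1 hW] at this
          · intro p hp q hq
            simp only [invRev, List.map_append, List.reverse_append, List.map_cons, List.map_nil,
              List.reverse_singleton, List.singleton_append, List.head?_cons, Option.mem_def,
              Option.some.injEq] at hq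
            simp only [List.map_append, List.map_cons, List.map_nil, List.getLast?_append,
              List.getLast?_singleton, Option.some_or, Option.mem_def, Option.some.injEq] at hp
            subst hp hq
            exact fun h => absurd h hz
        subst hz
        have hmk' : mk (W ++ [(z, true)]) = mk W * of z := hmk
        obtain ⟨i, hi, k, hs, hk⟩ := ih hW' (z :: r) (by simp) (by simpa using hlen) (by
          rw [← h, hmk', positive_append, positive_cons, positive_singleton]
          group)
        cases i with
        | zero =>
          -- Stepping back from rotation 0 wraps around to the last index and gains one factor `s`.
          refine ⟨r.length, by simp, k + 1, ?_, ?_⟩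
          · rw [List.rotate_append_length_eq, hs]
            simp
          · rw [List.take_left, zpow_add_one, ← hk, List.take_zero, positive_nil, hmk', hs]
            simp [positive_cons, mul_assoc]
        | succ i =>
          have hi' : i < r.length := by simpa using hi
          refine ⟨i, by simp; omega, k, ?_, ?_⟩
          · rw [hs, List.rotate_cons_succ]
          · rw [List.take_append_of_le_length hi'.le, ← hk, List.take_succ_cons, positive_cons,
              hmk',
              mul_assoc]

end FreeGroup

/-! ### Identities of length two. -/

namespace CyclicPresentation

open FreeGroup in
theorem shift_word_eq_positive (n i : ℕ) (j k l : ℤ) :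
    (freeShift n ^ i) (word n j k l) =
      positive [(i : ZMod n), i + j, i + k, i + l] := by
  rw [word, _root_.map_mul, _root_.map_mul, _root_.map_mul, freeShift_pow_of, freeShift_pow_of,
    freeShift_pow_of, freeShift_pow_of]
  simp only [positive_cons, positive_nil, mul_one, mul_assoc]
  rw [zero_add, add_comm (j : ZMod n), add_comm (k : ZMod n), add_comm (l : ZMod n)]

/-- Distinct relators are not conjugate, and the centralizer of a relator becomes trivial in the
presented group. -/
theorem relators_eq_of_conj {n : ℕ} {j k l : ℤ} (hC : ¬ CondC n j k l)
    {r s : FreeGroup (ZMod n)} (hr : r ∈ relators n (word n j k l))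
    (hs : s ∈ relators n (word n j k l)) {u v : FreeGroup (ZMod n)}
    (h : u * r * u⁻¹ = v * s * v⁻¹) :
    r = s ∧ PresentedGroup.mk (relators n (word n j k l)) u = PresentedGroup.mk _ v := by
  have hmk : PresentedGroup.mk (relators n (word n j k l)) s = 1 := PresentedGroup.one_of_mem hs
  obtain ⟨a, -, rfl⟩ := hr
  obtain ⟨b, -, rfl⟩ := hs
  rw [shift_word_eq_positive, shift_word_eq_positive] at h
  rw [shift_word_eq_positive] at hmk
  rw [shift_word_eq_positive, shift_word_eq_positive]
  have hC' : ¬ ((l : ZMod n) = j + k ∨ (l : ZMod n) = j - k) := by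
    rw [CondC, ← ZMod.intCast_eq_intCast_iff, ← ZMod.intCast_eq_intCast_iff] at hC
    push_cast at hC
    exact hC
  obtain ⟨i, hi, m, hs, hm⟩ := FreeGroup.exists_rotate_of_conj_positive
    (s := [(b : ZMod n), b + j, b + k, b + l]) (v⁻¹ * u).toWord FreeGroup.isReduced_toWord
    [(a : ZMod n), a + j, a + k, a + l] (by simp) rfl (by
      rw [FreeGroup.mk_toWord, mul_inv_rev, inv_inv, mul_assoc, mul_assoc, ← mul_assoc _ u⁻¹ v,
        ← mul_assoc u, ← mul_assoc u, h]
      group)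
  simp only [List.length_cons, List.length_nil] at hi
  rw [FreeGroup.mk_toWord] at hm
  -- Rotation by 0 makes `v⁻¹ u` a power of the relator, trivial in the group. Rotation by 1 or 2
  -- would force `l = j + k`, and by 3 would force `l = j - k`.
  obtain rfl | rfl | rfl | rfl : i = 0 ∨ i = 1 ∨ i = 2 ∨ i = 3 := by omega
  · rw [List.rotate_zero] at hs
    refine ⟨by rw [hs], ?_⟩
    rw [List.take_zero, FreeGroup.positive_nil, mul_one] at hm
    have := congrArg (PresentedGroup.mk (relators n (word n j k l))) hm
    rw [map_mul, map_zpow, hmk, one_zpow, map_inv, inv_mul_eq_one] at this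
    exact this.symm
  all_goals
    exfalso
    simp only [List.rotate_cons_succ, List.rotate_zero, List.cons_append, List.nil_append,
      List.cons.injEq, and_true] at hs
    obtain ⟨h1, h2, h3, h4⟩ := hs
    refine hC' ?_
  · exact Or.inl (by linear_combination h1 - h3)
  · exact Or.inl (by linear_combination h1 - h2)
  · exact Or.inr (by linear_combination h3 - h1)

/-- Every relator has exponent sum 4, so the two letters have opposite signs and equal boundaries.
By `relators_eq_of_conj` they have the same image, and the images cancel. -/
theorem hurewicz_eq_zero_of_norm_eq_two {n : ℕ} {j k l : ℤ}
    [DecidableEq (FreeGroup (ZMod n) × relators n (word n j k l))] (hC : ¬ CondC n j k l)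
    {y : GroupPresentation.RelFree (relators n (word n j k l))}
    (hy : y ∈ GroupPresentation.identities (relators n (word n j k l))) (hnorm : y.norm = 2) :
    GroupPresentation.hurewicz _ y = 0 := by
  obtain ⟨⟨⟨u, r⟩, b⟩, ⟨⟨v, s⟩, c⟩, hword⟩ := List.length_eq_two.1 hnorm
  have hy' : y = FreeGroup.mk [((u, r), b)] * FreeGroup.mk [((v, s), c)] := by
    rw [FreeGroup.mul_mk, List.singleton_append, ← hword, FreeGroup.mk_toWord]
  rw [MonoidHom.mem_ker] at hy
  let σ : FreeGroup (ZMod n) →* Multiplicative ℤ :=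
    FreeGroup.lift fun _ => Multiplicative.ofAdd (1 : ℤ)
  have hσ : ∀ r : relators n (word n j k l), σ r = Multiplicative.ofAdd (4 : ℤ) := by
    intro r
    obtain ⟨i, -, hi⟩ := r.2
    rw [hi, shift_word_eq_positive]
    simp only [FreeGroup.positive_cons, FreeGroup.positive_nil, map_mul, σ,
      FreeGroup.lift_apply_of, mul_one]
    rfl
  have hσb : ∀ (u : FreeGroup (ZMod n)) (r : relators n (word n j k l)),
      σ (GroupPresentation.boundary _
      (FreeGroup.of (u, r))) = Multiplicative.ofAdd (4 : ℤ) := by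
    intro u r
    rw [GroupPresentation.boundary_of, map_mul, map_mul, map_inv, mul_inv_cancel_comm, hσ]
  have hσy := congrArg σ hy
  have hfin : ∀ {u v : FreeGroup (ZMod n)} {r s : relators n (word n j k l)},
      GroupPresentation.boundary _ (FreeGroup.of (u, r)) =
        GroupPresentation.boundary _ (FreeGroup.of (v, s)) →
      GroupPresentation.hurewicz _ (FreeGroup.of (u, r)) =
        GroupPresentation.hurewicz _ (FreeGroup.of (v, s)) := by
    intro u v r s h
    rw [GroupPresentation.boundary_of, GroupPresentation.boundary_of] at h
    obtain ⟨h1, h2⟩ := relators_eq_of_conj hC r.2 s.2 h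
    rw [GroupPresentation.hurewicz_of, GroupPresentation.hurewicz_of, h2, Subtype.ext h1]
  have ht : ∀ p : FreeGroup (ZMod n) × relators n (word n j k l),
      FreeGroup.mk [(p, true)] = FreeGroup.of p := fun _ => rfl
  have hf : ∀ p : FreeGroup (ZMod n) × relators n (word n j k l),
      FreeGroup.mk [(p, false)] = (FreeGroup.of p)⁻¹ := fun _ => rfl
  cases b <;> cases c <;> simp only [ht, hf] at hy'
  · exfalso
    rw [hy', map_mul, map_mul, map_inv, map_inv, map_inv, map_inv, hσb, hσb, map_one] at hσy
    have := congrArg Multiplicative.toAdd hσy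
    simp at this
  · rw [hy', map_mul, map_inv, inv_mul_eq_one] at hy
    rw [hy', GroupPresentation.hurewicz_mul, GroupPresentation.hurewicz_inv, hfin hy,
      neg_add_cancel]
  · rw [hy', map_mul, map_inv, mul_inv_eq_one] at hy
    rw [hy', GroupPresentation.hurewicz_mul, GroupPresentation.hurewicz_inv, hfin hy,
      add_neg_cancel]
  · exfalso
    rw [hy', map_mul, map_mul, hσb, hσb, map_one] at hσy
    have := congrArg Multiplicative.toAdd hσy
    simp at this

/-! ### Reduction of the four-letter relation to the two families. -/

namespace IsQuarticExtension

variable {n : ℕ} {E : Type} [Group E] {t x : E}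

/-- Reduction to two families of relations, when two consecutive exponents agree. -/
theorem reduce {a b c d : ℤ} (h : IsQuarticExtension n a b c d t x) (hsum : a + b + c + d = 0)
    (hab : (n : ℤ) ∣ b - a) (hA : (n : ℤ) ∣ 2 * (a + b) ∨ (n : ℤ) ∣ 2 * (b + c))
    (hac : ¬ (n : ℤ) ∣ c - a) :
    ∃ e p : ℤ, ¬ (n : ℤ) ∣ p ∧ (IsQuarticExtension n 0 0 p (-p) t (x * t ^ e) ∨
      IsQuarticExtension n 0 0 p p t (x * t ^ e)) ∧
      ∀ m : ℤ, m ∣ n → (m ∣ p ↔ m ∣ b - a ∧ m ∣ c - b ∧ m ∣ d - c ∧ m ∣ a - d) := by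
  have h0 : a ≡ a + 0 [ZMOD n] := by rw [add_zero]
  have h1 : b ≡ a + 0 [ZMOD n] := by rw [add_zero]; exact (Int.modEq_iff_dvd.2 hab).symm
  have h2 : c ≡ a + (c - a) [ZMOD n] := by rw [add_sub_cancel]
  -- Subtracting `a` leaves exponents `0, 0, p, d - a`. As the sum is zero and `a ≡ b`, one has `d -
  -- a ≡ -4a - p`, which (A) turns into `-p` or `p`.
  refine ⟨a, c - a, hac, ?_, ?_⟩
  · rcases hA with hA | hA
    · refine Or.inl (h.subst a h0 h1 h2 (Int.modEq_iff_dvd.2 ?_))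
      have : a + -(c - a) - d = 2 * (a + b) - (b - a) := by linarith
      rw [this]
      exact dvd_sub hA hab
    · refine Or.inr (h.subst a h0 h1 h2 (Int.modEq_iff_dvd.2 ?_))
      have : a + (c - a) - d = 2 * (b + c) - (b - a) := by linarith
      rw [this]
      exact dvd_sub hA hab
  · intro m hm
    have hab' := hm.trans hab
    constructor
    · intro hp
      have h3 : m ∣ c - b := by
        rw [show c - b = (c - a) - (b - a) by ring]
        exact dvd_sub hp hab'
      have h4 : m ∣ d - c := by
        rcases hA with hA | hA
        · rw [show d - c = -(2 * (a + b)) + (b - a) - 2 * (c - a) by linarith]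
          exact dvd_sub (dvd_add (hm.trans hA).neg_right hab') (hp.mul_left 2)
        · rw [show d - c = -(2 * (b + c)) + (b - a) by linarith]
          exact dvd_add (hm.trans hA).neg_right hab'
      refine ⟨hab', h3, h4, ?_⟩
      rw [show a - d = -((c - a) + (d - c)) by ring]
      exact (dvd_add hp h4).neg_right
    · rintro ⟨-, h3, -, -⟩
      rw [show c - a = (c - b) + (b - a) by ring]
      exact dvd_add h3 hab'

end IsQuarticExtension

theorem dvd_secondaryDivisor_iff (n : ℕ) (j k l : ℤ) (m : ℕ) :
    m ∣ secondaryDivisor n j k l ↔ (m : ℤ) ∣ n ∧ (m : ℤ) ∣ k - 2 * j ∧ (m : ℤ) ∣ j - 2 * k + l ∧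
      (m : ℤ) ∣ k - 2 * l ∧ (m : ℤ) ∣ j + l := by
  rw [secondaryDivisor, Nat.dvd_gcd_iff, ← Int.natCast_dvd_natCast, ← Int.natCast_dvd_natCast,
    Int.dvd_coe_gcd_iff, Int.dvd_coe_gcd_iff, Int.dvd_coe_gcd_iff]

/-- The differences of cyclically consecutive exponents are, up to order, the four numbers in the
secondary divisor. Each alternative of (B) makes one of them vanish modulo `n`, and a rotation
brings that pair to the front; an odd number of rotations exchanges the alternatives of (A) and
those of (C). -/
theorem exists_reduction {n : ℕ} {j k l : ℤ} (hA : CondA n j k l) (hB : CondB n j k l)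
    (hC : ¬ CondC n j k l) {E : Type} [Group E] {t x : E}
    (h : IsQuarticExtension n j (k - j) (l - k) (-l) t x) :
    ∃ e p : ℤ, ¬ (n : ℤ) ∣ p ∧ (IsQuarticExtension n 0 0 p (-p) t (x * t ^ e) ∨
      IsQuarticExtension n 0 0 p p t (x * t ^ e)) ∧
      (secondaryDivisor n j k l = 1 ↔ Int.gcd n p = 1) := by
  suffices hs : ∃ e p : ℤ, ¬ (n : ℤ) ∣ p ∧ (IsQuarticExtension n 0 0 p (-p) t (x * t ^ e) ∨
      IsQuarticExtension n 0 0 p p t (x * t ^ e)) ∧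
      ∀ m : ℤ, m ∣ n → (m ∣ p ↔ m ∣ k - 2 * j ∧ m ∣ j - 2 * k + l ∧ m ∣ k - 2 * l ∧ m ∣ j + l) by
    obtain ⟨e, p, h1, h2, h3⟩ := hs
    have h4 : secondaryDivisor n j k l = Int.gcd n p := by
      refine Nat.dvd_left_iff_eq.1 fun m => ?_
      rw [dvd_secondaryDivisor_iff, ← Int.natCast_dvd_natCast, Int.dvd_coe_gcd_iff]
      exact and_congr_right fun hm => (h3 m hm).symm
    exact ⟨e, p, h1, h2, by rw [h4]⟩
  rw [CondA, Int.modEq_iff_dvd, Int.modEq_iff_dvd] at hA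
  rw [CondB, Int.modEq_iff_dvd, Int.modEq_iff_dvd, Int.modEq_iff_dvd, Int.modEq_iff_dvd] at hB
  rw [CondC, Int.modEq_iff_dvd, Int.modEq_iff_dvd, not_or] at hC
  obtain ⟨hC1, hC2⟩ := hC
  have hmul : ∀ {m u v : ℤ} (c : ℤ), m ∣ u → v = c * u → m ∣ v :=
    fun c h hv => hv ▸ h.mul_left c
  rcases hB with hB | hB | hB | hB
  · obtain ⟨e, p, h1, h2, h3⟩ := h.reduce (by ring) (hmul (-1) hB (by ring))
      (hA.imp (fun h => hmul (-1) h (by ring)) fun h => hmul 1 h (by ring))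
      (fun h => hC1 (hmul (-1) h (by ring)))
    refine ⟨e, p, h1, h2, fun m hm => (h3 m hm).trans ?_⟩
    rw [show k - j - j = k - 2 * j by ring, show l - k - (k - j) = j - 2 * k + l by ring,
      show -l - (l - k) = k - 2 * l by ring, show j - -l = j + l by ring]
  · obtain ⟨e, p, h1, h2, h3⟩ := h.rotate.rotate.reduce (by ring) (hmul (-1) hB (by ring))
      (hA.imp (fun h => hmul 1 h (by ring)) fun h => hmul (-1) h (by ring))
      (fun h => hC1 (hmul 1 h (by ring)))
    refine ⟨e, p, h1, h2, fun m hm => (h3 m hm).trans ?_⟩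
    rw [show k - j - j = k - 2 * j by ring, show l - k - (k - j) = j - 2 * k + l by ring,
      show -l - (l - k) = k - 2 * l by ring, show j - -l = j + l by ring]
    tauto
  · obtain ⟨e, p, h1, h2, h3⟩ := h.rotate.reduce (by ring) (hmul (-1) hB (by ring))
      (hA.symm.imp (fun h => hmul 1 h (by ring)) fun h => hmul 1 h (by ring))
      (fun h => hC2 (hmul 1 h (by ring)))
    refine ⟨e, p, h1, h2, fun m hm => (h3 m hm).trans ?_⟩
    rw [show k - j - j = k - 2 * j by ring, show l - k - (k - j) = j - 2 * k + l by ring,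
      show -l - (l - k) = k - 2 * l by ring, show j - -l = j + l by ring]
    tauto
  · obtain ⟨e, p, h1, h2, h3⟩ := h.rotate.rotate.rotate.reduce (by ring) (hmul (-1) hB (by ring))
      (hA.symm.imp (fun h => hmul (-1) h (by ring)) fun h => hmul (-1) h (by ring))
      (fun h => hC2 (hmul (-1) h (by ring)))
    refine ⟨e, p, h1, h2, fun m hm => (h3 m hm).trans ?_⟩
    rw [show k - j - j = k - 2 * j by ring, show l - k - (k - j) = j - 2 * k + l by ring,
      show -l - (l - k) = k - 2 * l by ring, show j - -l = j + l by ring]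
    tauto

end CyclicPresentation

/-! ### Translation back to the shift, and the theorem. -/

namespace CyclicPresentation

theorem map_shift_pow {n : ℕ} {w : FreeGroup (ZMod n)} {E : Type} [Group E] {ι : CycGroup n w →* E}
    {t : E} (hshift : ∀ g, ι (shift n w g) = t * ι g * t⁻¹) (d : ℕ) (g : CycGroup n w) :
    ι ((shift n w ^ d) g) = t ^ d * ι g * (t ^ d)⁻¹ := by
  induction d with
  | zero => simp
  | succ d ih =>
    rw [pow_succ', MulAut.mul_apply, hshift, ih, pow_succ' t]
    group

theorem shift_pow_apply_eq_iff {n : ℕ} {w : FreeGroup (ZMod n)} {E : Type} [Group E]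
    {ι : CycGroup n w →* E} (hι : Function.Injective ι) {t : E}
    (hshift : ∀ g, ι (shift n w g) = t * ι g * t⁻¹) (d : ℕ) (g : CycGroup n w) :
    (shift n w ^ d) g = g ↔ Commute (ι g) (t ^ d) := by
  rw [← hι.eq_iff, map_shift_pow hshift, mul_inv_eq_iff_eq_mul]
  exact eq_comm

end CyclicPresentation

theorem mainTheorem8 (n : ℕ) (hn : 0 < n) (j k l : ℤ)
    (hA : CyclicPresentation.CondA n j k l)
    (hB : CyclicPresentation.CondB n j k l)
    (hC : ¬ CyclicPresentation.CondC n j k l) :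
    (¬ CyclicPresentation.ShiftActsFreely n (CyclicPresentation.word n j k l) ∧
      ¬ GroupPresentation.CombinatoriallyAspherical
        (CyclicPresentation.relators n (CyclicPresentation.word n j k l))) ∧
    (Finite (CyclicPresentation.CycGroup n (CyclicPresentation.word n j k l)) ↔
      CyclicPresentation.secondaryDivisor n j k l = 1) ∧
    (CyclicPresentation.secondaryDivisor n j k l = 1 ↔
      ∃ g : CyclicPresentation.CycGroup n (CyclicPresentation.word n j k l), g ≠ 1 ∧
        CyclicPresentation.shift n (CyclicPresentation.word n j k l) g = g) ∧
    (Finite (CyclicPresentation.CycGroup n (CyclicPresentation.word n j k l)) →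
      Group.IsSolvable (CyclicPresentation.CycGroup n (CyclicPresentation.word n j k l)) ∧
      (CyclicPresentation.IsMetacyclic
          (CyclicPresentation.CycGroup n (CyclicPresentation.word n j k l)) ∨
        CyclicPresentation.IsCyclicCentralExtensionOfDihedral
          (CyclicPresentation.CycGroup n (CyclicPresentation.word n j k l)))) := by
  obtain ⟨E, _, ι, π, t, x, hι, hrange, hshift, ht, hx, h⟩ :=
    CyclicPresentation.exists_isQuarticExtension n hn j k l
  obtain ⟨e, p, hp, hcase, hγ⟩ := CyclicPresentation.exists_reduction hA hB hC h
  have hy : π (x * t ^ e) = Multiplicative.ofAdd (e : ZMod n) := by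
    rw [map_mul, hx, one_mul, CyclicPresentation.IsQuarticExtension.map_zpow_eq ht]
  have htn : t ^ n = 1 := h.pow_eq_one
  have hlift : ∀ g ∈ π.ker, g ≠ 1 → ∃ g', g' ≠ 1 ∧ ι g' = g := by
    intro g hg hg1
    rw [← hrange] at hg
    obtain ⟨g', rfl⟩ := hg
    exact ⟨g', fun h => hg1 (by rw [h, map_one]), rfl⟩
  obtain ⟨g, hg1, hg⟩ : ∃ g, g ≠ 1 ∧ Commute (ι g) (t ^ p) := by
    obtain ⟨g, hg, hg1, hgt⟩ : ∃ g ∈ π.ker, g ≠ 1 ∧ Commute g (t ^ p) := by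
      rcases hcase with h | h
      · exact h.exists_commute hn hp ht hy
      · obtain ⟨g, hg, hg1, -, hgt⟩ := h.exists_torsion_commute (π := π) hn hp
        exact ⟨g, hg, hg1, hgt⟩
    obtain ⟨g', hg', rfl⟩ := hlift g hg hg1
    exact ⟨g', hg', hgt⟩
  obtain ⟨z, hz1, hz⟩ : ∃ z : CyclicPresentation.CycGroup n (CyclicPresentation.word n j k l),
      z ≠ 1 ∧ IsOfFinOrder z := by
    obtain ⟨g, hg, hg1, hgt⟩ : ∃ g ∈ π.ker, g ≠ 1 ∧ IsOfFinOrder g := by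
      rcases hcase with h | h
      · exact h.exists_torsion hn hp
      · obtain ⟨g, hg, hg1, hgt, -⟩ := h.exists_torsion_commute (π := π) hn hp
        exact ⟨g, hg, hg1, hgt⟩
    obtain ⟨g', hg', rfl⟩ := hlift g hg hg1
    exact ⟨g', hg', (hι.isOfFinOrder_iff).1 hgt⟩
  have hfin : Finite (CyclicPresentation.CycGroup n (CyclicPresentation.word n j k l)) ↔
      CyclicPresentation.secondaryDivisor n j k l = 1 := by
    rw [hγ]
    constructor
    · intro hG
      by_contra hgcd
      have hinf : Infinite π.ker := by
        rcases hcase with h | h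
        · exact h.infinite_ker (e := -1) (by ring) hn π hgcd
        · exact h.infinite_ker (e := 1) (by ring) hn π hgcd
      rw [← hrange] at hinf
      exact hinf.not_finite (Finite.of_surjective _ ι.rangeRestrict_surjective)
    · intro hgcd
      have : Finite E := by
        rcases hcase with h | h
        · exact h.finite_of_gcd_eq_one hn hp hgcd
        · exact h.finite_of_gcd_eq_one' hn hgcd
      exact Finite.of_injective _ hι
  refine ⟨⟨fun hfree => ?_, ?_⟩, hfin, ?_, fun hG => ?_⟩
  · have hn0 : (n : ℤ) ≠ 0 := by exact_mod_cast hn.ne'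
    have h0 := Int.emod_nonneg p hn0
    have h1 : p % n ≠ 0 := fun h => hp (Int.dvd_of_emod_eq_zero h)
    have h2 := Int.emod_lt_of_pos p (b := n) (by exact_mod_cast hn)
    -- The exponent `p` is reduced to the range `0 < d < n`; it stays nonzero because `n ∤ p`.
    have htp : t ^ (p % n).toNat = t ^ p := by
      rw [← zpow_natCast, Int.toNat_of_nonneg h0]
      exact zpow_eq_zpow_of_modEq htn (Int.mod_modEq p n)
    refine hfree (p % n).toNat (by omega) (by omega) g hg1 ?_
    rw [CyclicPresentation.shift_pow_apply_eq_iff hι hshift, htp]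
    exact hg
  · exact GroupPresentation.not_combinatoriallyAspherical _ hz1 hz fun y hy hnorm =>
      CyclicPresentation.hurewicz_eq_zero_of_norm_eq_two hC hy (by convert hnorm)
  · rw [hγ]
    constructor
    · intro hgcd
      obtain ⟨m, hm⟩ :=
        CyclicPresentation.IsQuarticExtension.exists_pow_eq_of_gcd_eq_one htn hn hgcd
      -- The same `g` serves: it commutes with `t^p`, of which `t` is a power.
      refine ⟨g, hg1, ?_⟩
      have := CyclicPresentation.shift_pow_apply_eq_iff hι hshift 1 g
      rw [pow_one, pow_one] at this
      rw [this, ← hm]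
      exact hg.pow_right m
    · rintro ⟨f, hf1, hf⟩
      by_contra hgcd
      have hft := CyclicPresentation.shift_pow_apply_eq_iff hι hshift 1 f
      rw [pow_one, pow_one] at hft
      have hker : ι f ∈ π.ker := hrange ▸ ⟨f, rfl⟩
      have : ι f = 1 := by
        rcases hcase with h | h
        · exact h.eq_one_of_commute (e := -1) (by ring) ht hgcd hker (hft.1 hf)
        · exact h.eq_one_of_commute (e := 1) (by ring) ht hgcd hker (hft.1 hf)
      exact hf1 (hι (by rw [this, map_one]))
  · have hgcd := hγ.1 (hfin.1 hG)
    have hor : CyclicPresentation.IsMetacyclic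
          (CyclicPresentation.CycGroup n (CyclicPresentation.word n j k l)) ∨
        CyclicPresentation.IsCyclicCentralExtensionOfDihedral
          (CyclicPresentation.CycGroup n (CyclicPresentation.word n j k l)) := by
      rcases hcase with h | h
      · exact Or.inl ((h.isMetacyclic_of_gcd_eq_one hn hp hgcd).of_injective hι)
      · exact h.isMetacyclic_or_isCyclicCentralExtension hn hgcd ht hy hι hrange
    exact ⟨hor.elim (fun h => h.isSolvable) fun h => h.isSolvable, hor⟩
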